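/- **Setting.** Let $\mathcal S,\mathcal A$ be standard Borel spaces and $H$ a horizon. Every state $s$ carries a time step $t(s)$. A source MDP $M^S$ and a target MDP $M^T$ are given; each consists of a law of the initial state $s_1$ (at the first time step) and a kernel $P(r,s'\mid s,a)$ giving the joint law of the reward $r\in[0,1]$ and the next state, where each transition advances the time step by one. (The two MDPs may share the reward law, but this is not needed.) For a policy $\pi(a\mid s)$ let $J^T(\pi)$ be its expected total reward over $H$ steps in $M^T$, and let $d^S_\pi,d^T_\pi$ be its state occupancies, $d_\pi=\frac1H\sum_{h=1}^H\mathrm{Law}(s_h)$. Let $\beta$ be a behavior policy, used in both environments. For a trajectory, $g_h=\sum_{k\ge h}r_k$ is the return-to-go; $P^T_\beta(g\mid s)$, $P^T_\beta(a\mid s,g)$ denote conditional laws under $\beta$ in $M^T$, and $G^S_\beta(\cdot;s,a)$, $G^T_\beta(\cdot;s,a)$ are the cumulative distribution functions of the return-to-go given $(s,a)$ under $\beta$ in $M^S$, $M^T$. **Oracle.** The relabelling oracle is $\psi(g;s,a)=(G^T_\beta)^{-1}\big(G^S_\beta(g;s,a);s,a\big)$ with the generalized inverse $G^{-1}(q)=\inf\{y: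 q\le G(y)\}$. Assume that for almost every $(s,a)\sim d^S_\beta\otimes\beta$ every value of $G^T_\beta(\cdot;s,a)$ lies in the closure of the range of $G^S_\beta(\cdot;s,a)$ (for instance, $G^S_\beta(\cdot;s,a)$ is continuous, or equals $G^T_\beta(\cdot;s,a)$). **Data and learning.** The dataset consists of $N^T$ target and $N^S$ source trajectories, $N^T+N^S\ge1$, all independent and collected by $\beta$. Policies $\pi(a\mid s,g)$ are given by densities with respect to a fixed $\sigma$-finite reference measure on $\mathcal A$; let $\Pi$ be a set of such policies. Let $\hat\pi\in\Pi$ be any minimizer over $\Pi$ of the empirical negative log-likelihood $$\hat L^{\mathrm{mix}}(\pi)=-\sum_{\tau\ \text{target}}\sum_{h=1}^H\log\pi(a_h\mid s_h,g_h)-\sum_{\tau\ \text{source}}\sum_{h=1}^H\log\pi\big(a_h\mid s_h,\psi(g_h;s_h,a_h)\big).$$ For a measurable $f:\mathcal S\to\mathbb R$ put $\hat\pi_f(a\mid s)=\hat\pi(a\mid s,f(s))$ and $\pi_f^{\mathrm{RCSL}}(a\mid s)=P^T_\beta(a\mid s,g=f(s))$. With $d^{\mathrm{mix}}_\beta=\frac{N^T}{N^T+N^S}d^T_\beta+\frac{N^S}{N^T+N^S}d^S_\beta$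 let $$L(\pi)=\mathbb E_{s\sim d^{\mathrm{mix}}_\beta,\ g\sim P^T_\beta(\cdot\mid s)}\,D_{\mathrm{KL}}\big(P^T_\beta(\cdot\mid s,g)\,\|\,\pi(\cdot\mid s,g)\big).$$ **Assumptions.** Let $\pi^\star:\mathcal S\to\mathcal A$ be an optimal policy of $M^T$, let $\alpha_f,\gamma_f>0$, $C_f,\epsilon,c,\epsilon_{\mathrm{approx}}\in\mathbb R$ and $0<\delta<1$, and let $f$ satisfy, for some measurable functions $T:\mathcal S\times\mathcal A\to\mathcal S$ and $r:\mathcal S\times\mathcal A\to\mathbb R$: 1. (return coverage) $P^T_\beta(g=f(s)\mid s)\ge\alpha_f$ for almost every initial state and for $d^T_{\pi_f^{\mathrm{RCSL}}}$-almost every state $s$ of $M^T$; 2. (near determinism) in $M^T$, $P(r\ne r(s,a)\text{ or }s'\ne T(s,a)\mid s,a)\le\epsilon$ for all $(s,a)$; 3. (consistency of $f$) $f(s)=f(s')+r$ for all $(s,a)$ with $s$ not at the last time step and almost every transition $(r,s')$ of $M^T$ from $(s,a)$; 4. (optimality of $f$) for almost every initial state $s_1$ of $M^T$, $f(s_1)$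 is at least the return collected by $\pi^\star$ from $s_1$ in $H$ steps under the noiseless dynamics $(T,r)$; 5. (bounded occupancy mismatch) $d^T_{\pi_f^{\mathrm{RCSL}}}\le C_f\,d^T_\beta$; 6. (domain occupancy overlap) $d^T_\beta\le\gamma_f\,d^S_\beta$; 7. (policy class) $\Pi$ is finite, its densities are positive, $|\log\pi(a\mid s,g)-\log\pi(a'\mid s',g')|\le c$ for all $\pi\in\Pi$ and all arguments, and $\min_{\pi\in\Pi}L(\pi)\le\epsilon_{\mathrm{approx}}$. **Theorem.** There is a universal constant $K>0$ such that, in every such situation, with probability at least $1-\delta$ over the dataset, every minimizer $\hat\pi$ of $\hat L^{\mathrm{mix}}$ over $\Pi$ satisfies $$J^T(\pi^\star)-J^T(\hat\pi_f)\le K\Big(\frac{C_f}{\alpha_f}\,\frac{N^S+N^T}{N^S/\gamma_f+N^T}\,H^2\Big(\sqrt c\,\Big(\frac{\log(|\Pi|/\delta)}{N^T+N^S}\Big)^{1/4}+\sqrt{\epsilon_{\mathrm{approx}}}\Big)+\frac{\epsilon}{\alpha_f}H^2\Big),$$ and, in particular, with leading coefficients that do not involve $N^T,N^S$, $$J^T(\pi^\star)-J^T(\hat\pi_f)\le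 K\Big(\frac{C_f\gamma_f}{\alpha_f}H^2\sqrt c\,\big(\log(|\Pi|/\delta)\big)^{1/4}\,(N^T+N^S)^{-1/4}+\frac{C_f\gamma_f}{\alpha_f}H^2\sqrt{\epsilon_{\mathrm{approx}}}+\frac{\epsilon}{\alpha_f}H^2\Big).$$ -/

import Mathlib

open MeasureTheory ProbabilityTheory
open scoped ENNReal

namespace RCSL

section Kernels

variable {X Y : Type*} [MeasurableSpace X] [MeasurableSpace Y]

/-- The kernel `x ↦ κ (n x) x` obtained from a sequence of kernels by choosing the index
measurably from the input. -/
noncomputable def pick (κ : ℕ → Kernel X Y) (n : X → ℕ) (hn : Measurable n) : Kernel X Y where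
  toFun x := κ (n x) x
  measurable' := by
    have h : Measurable fun p : X × ℕ => κ p.2 p.1 :=
      measurable_from_prod_countable_left fun k => (κ k).measurable
    exact h.comp (measurable_id.prodMk hn)

instance instMarkovPick (κ : ℕ → Kernel X Y) [hκ : ∀ k, IsMarkovKernel (κ k)] (n : X → ℕ)
    (hn : Measurable n) : IsMarkovKernel (pick κ n hn) :=
  ⟨fun x => (hκ (n x)).isProbabilityMeasure x⟩

end Kernels

/-- The clock of an episodic decision problem with horizon `H`: every state carries its time step.
Time steps are counted from `0` to `H - 1`. -/
structure Episode (S : Type*) [MeasurableSpace S] where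
  H : ℕ
  time : S → ℕ
  measurable_time : Measurable time

variable {S A : Type*} [MeasurableSpace S] [MeasurableSpace A]

/-- An episodic Markov decision process: the law of the initial state, and, for every state and
action, the joint law of the reward and the next state. Rewards lie in `[0, 1]`. -/
structure MDP (E : Episode S) (A : Type*) [MeasurableSpace A] where
  init : Measure S
  step : Kernel (S × A) (ℝ × S)
  prob_init : IsProbabilityMeasure init
  markov_step : IsMarkovKernel step
  time_init : ∀ᵐ s ∂init, E.time s = 0
  time_step : ∀ s a, E.time s + 1 < E.H → ∀ᵐ x ∂step (s, a), E.time x.2 = E.time s + 1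
  reward_mem : ∀ s a, ∀ᵐ x ∂step (s, a), x.1 ∈ Set.Icc (0 : ℝ) 1

attribute [instance] MDP.prob_init MDP.markov_step

/-- Trajectories `(s_0, a_0, r_0, …, s_{n-1}, a_{n-1}, r_{n-1})`. -/
abbrev Traj (S A : Type*) (n : ℕ) := Fin n → S × A × ℝ

/-- The return-to-go `g_h = ∑_{k ≥ h} r_k`. -/
noncomputable def returnToGo {n : ℕ} (τ : Traj S A n) (h : Fin n) : ℝ :=
  ∑ k ∈ Finset.Ici h, (τ k).2.2

/-- The return `∑_k r_k`. -/
noncomputable def totalReturn {n : ℕ} (τ : Traj S A n) : ℝ := ∑ k, (τ k).2.2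

namespace MDP

variable {E : Episode S} (M : MDP E A) (π : Kernel S A) [IsMarkovKernel π]

/-- The law of the next `n` steps when policy `π` is run from a given state. -/
noncomputable def trajLaw : (n : ℕ) → Kernel S (Traj S A n)
  | 0 => Kernel.const S (Measure.dirac Fin.elim0)
  | n + 1 =>
    (Kernel.id ×ₖ ((π ⊗ₖ M.step) ⊗ₖ
        (trajLaw n).comap (fun y : S × (A × (ℝ × S)) => y.2.2.2) (by fun_prop))).map
      (fun z : S × ((A × (ℝ × S)) × Traj S A n) =>
        (Fin.cons (z.1, z.2.1.1, z.2.1.2.1) z.2.2 : Traj S A (n + 1)))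

theorem measurable_cons (n : ℕ) :
    Measurable (fun z : S × ((A × (ℝ × S)) × Traj S A n) =>
      (Fin.cons (z.1, z.2.1.1, z.2.1.2.1) z.2.2 : Traj S A (n + 1))) := by
  refine measurable_pi_lambda _ fun i => ?_
  refine Fin.cases ?_ (fun j => ?_) i
  · simp only [Fin.cons_zero]; fun_prop
  · simp only [Fin.cons_succ]; fun_prop

instance instMarkovTrajLaw (n : ℕ) : IsMarkovKernel (M.trajLaw π n) := by
  induction n with
  | zero => rw [trajLaw]; infer_instance
  | succ n ih =>
    rw [trajLaw]
    exact Kernel.IsMarkovKernel.map _ (measurable_cons n)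

theorem measurable_totalReturn (n : ℕ) :
    Measurable (totalReturn : Traj S A n → ℝ) := by
  unfold totalReturn; fun_prop

/-- The law of a whole trajectory under `π`. -/
noncomputable def trajMeasure : Measure (Traj S A E.H) := M.init.bind (M.trajLaw π E.H)

/-- The expected return `J(π)`. -/
noncomputable def value : ℝ := ∫ τ, totalReturn τ ∂M.trajMeasure π

/-- The state occupancy `d_π = H⁻¹ ∑_h Law(s_h)`. -/
noncomputable def occupancy : Measure S :=
  (E.H : ℝ≥0∞)⁻¹ • ∑ h : Fin E.H, (M.trajMeasure π).map (fun τ => (τ h).1)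

/-- The law of the reward plus the return of `n` further steps, given state and action. -/
noncomputable def stepReturn (n : ℕ) : Kernel (S × A) ℝ :=
  (M.step ⊗ₖ ((M.trajLaw π n).map totalReturn).comap
      (fun y : (S × A) × (ℝ × S) => y.2.2) (by fun_prop)).map
    (fun z : (ℝ × S) × ℝ => z.1.1 + z.2)

instance instMarkovStepReturn (n : ℕ) : IsMarkovKernel (M.stepReturn π n) := by
  have := Kernel.IsMarkovKernel.map (M.trajLaw π n) (measurable_totalReturn (S := S) (A := A) n)
  rw [stepReturn]
  exact Kernel.IsMarkovKernel.map _ (by fun_prop)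

/-- `P_π(g ∈ · | s, a)`: the law of the return-to-go given state and action. -/
noncomputable def returnGivenSA : Kernel (S × A) ℝ :=
  pick (M.stepReturn π) (fun x => E.H - (E.time x.1 + 1))
    (by have := E.measurable_time; fun_prop)

instance instMarkovReturnGivenSA : IsMarkovKernel (M.returnGivenSA π) := by
  rw [returnGivenSA]; infer_instance

/-- `P_π((g, a) ∈ · | s)`: the joint law of the return-to-go and the action given the state. -/
noncomputable def returnAction : Kernel S (ℝ × A) := (π ⊗ₖ M.returnGivenSA π).swapRight

instance instMarkovReturnAction : IsMarkovKernel (M.returnAction π) := by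
  rw [returnAction]; infer_instance

/-- `P_π(g ∈ · | s)`: the law of the return-to-go given the state. -/
noncomputable def returnGivenS : Kernel S ℝ := (M.returnAction π).fst

/-- `P_π(a ∈ · | s, g)`: the conditional law of the action given state and return-to-go. -/
noncomputable def actionGiven [StandardBorelSpace A] [Nonempty A] : Kernel (S × ℝ) A :=
  (M.returnAction π).condKernel

instance instMarkovActionGiven [StandardBorelSpace A] [Nonempty A] :
    IsMarkovKernel (M.actionGiven π) := by
  rw [actionGiven]; infer_instance

end MDP

/-- The policy `s ↦ κ(· | s, f(s))` obtained by conditioning on the return `f(s)`. -/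
noncomputable def conditionOn (κ : Kernel (S × ℝ) A) (f : S → ℝ) (hf : Measurable f) :
    Kernel S A :=
  κ.comap (fun s => (s, f s)) (by fun_prop)

instance instMarkovConditionOn (κ : Kernel (S × ℝ) A) [IsMarkovKernel κ] (f : S → ℝ)
    (hf : Measurable f) : IsMarkovKernel (conditionOn κ f hf) := by
  rw [conditionOn]; infer_instance

/-- A return-conditioned policy `π(a | s, g)`, given by its density with respect to a reference
measure `μ` on the actions (the counting measure if there are finitely many). -/
structure RCPolicy (S : Type*) {A : Type*} [MeasurableSpace S] [MeasurableSpace A]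
    (μ : Measure A) where
  density : S → ℝ → A → ℝ
  measurable_density : Measurable fun x : (S × ℝ) × A => density x.1.1 x.1.2 x.2
  nonneg : ∀ s g a, 0 ≤ density s g a
  lintegral_eq_one : ∀ s g, ∫⁻ a, ENNReal.ofReal (density s g a) ∂μ = 1

/-- The law `π(· | s, g)` of the action. -/
noncomputable def RCPolicy.toKernel {μ : Measure A} [SFinite μ] (p : RCPolicy S μ) :
    Kernel (S × ℝ) A :=
  (Kernel.const (S × ℝ) μ).withDensity fun x a => ENNReal.ofReal (p.density x.1 x.2 a)

instance instMarkovToKernel {μ : Measure A} [SFinite μ] (p : RCPolicy S μ) :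
    IsMarkovKernel p.toKernel := by
  refine ⟨fun x => ⟨?_⟩⟩
  have h : Measurable (Function.uncurry fun (x : S × ℝ) (a : A) =>
      ENNReal.ofReal (p.density x.1 x.2 a)) := p.measurable_density.ennreal_ofReal
  rw [RCPolicy.toKernel, Kernel.withDensity_apply' _ h]
  simpa using p.lintegral_eq_one x.1 x.2

/-- The generalized inverse `q ↦ inf {y | q ≤ G(y)}` of a cumulative distribution function. -/
noncomputable def quantile (G : ℝ → ℝ) (q : ℝ) : ℝ := sInf {y | q ≤ G y}

section Oracle

variable {E : Episode S} (src tgt : MDP E A) (β : Kernel S A) [IsMarkovKernel β]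

/-- `G_β(g; s, a)`: the distribution function of the return-to-go given state and action. -/
noncomputable def returnCDF (M : MDP E A) (s : S) (a : A) (g : ℝ) : ℝ :=
  cdf (M.returnGivenSA β (s, a)) g

/-- The relabelling oracle `ψ(g) = (G^T)⁻¹(G^S(g; s, a); s, a)`. -/
noncomputable def relabel (s : S) (a : A) (g : ℝ) : ℝ :=
  quantile (returnCDF β tgt s a) (returnCDF β src s a g)

/-- The source distribution function attains, at least as a limit, every value of the target
distribution function, for almost all pairs `(s, a)` in the source data. It holds if the source distribution functions are
continuous, and also if the two distribution functions agree. -/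
def CDFCompatible : Prop :=
  ∀ᵐ x ∂(src.occupancy β) ⊗ₘ β,
    Set.range (returnCDF β tgt x.1 x.2) ⊆ closure (Set.range (returnCDF β src x.1 x.2))

variable {μ : Measure A} (NT NS : ℕ)

/-- A dataset: `NT` target trajectories and `NS` source trajectories. -/
abbrev Dataset (S A : Type*) (H NT NS : ℕ) := (Fin NT → Traj S A H) × (Fin NS → Traj S A H)

/-- The law of the dataset: all trajectories are independent and collected by `β`. -/
noncomputable def dataLaw : Measure (Dataset S A E.H NT NS) :=
  (Measure.pi fun _ : Fin NT => tgt.trajMeasure β).prod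
    (Measure.pi fun _ : Fin NS => src.trajMeasure β)

variable {NT NS}

/-- The empirical negative log-likelihood on the mixed dataset, where the returns-to-go of the
source trajectories are relabelled. -/
noncomputable def empLoss (D : Dataset S A E.H NT NS) (p : RCPolicy S μ) : ℝ :=
  (-∑ i, ∑ h, Real.log (p.density (D.1 i h).1 (returnToGo (D.1 i) h) (D.1 i h).2.1)) +
  (-∑ j, ∑ h, Real.log (p.density (D.2 j h).1
      (relabel src tgt β (D.2 j h).1 (D.2 j h).2.1 (returnToGo (D.2 j) h)) (D.2 j h).2.1))

/-- `p` minimizes the empirical loss over the policy class. -/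
def IsEmpiricalMinimizer (P : Finset (RCPolicy S μ)) (D : Dataset S A E.H NT NS)
    (p : RCPolicy S μ) : Prop :=
  p ∈ P ∧ ∀ q ∈ P, empLoss src tgt β D p ≤ empLoss src tgt β D q

variable (NT NS)

/-- The mixed occupancy `N^T/(N^T+N^S) d^T_β + N^S/(N^T+N^S) d^S_β`. -/
noncomputable def mixOccupancy : Measure S :=
  ((NT : ℝ≥0∞) / (NT + NS)) • tgt.occupancy β + ((NS : ℝ≥0∞) / (NT + NS)) • src.occupancy β

/-- The population loss
`L(π) = E_{s ∼ d^mix_β, g ∼ P^T_β(· | s)} KL(P^T_β(· | s, g) ‖ π(· | s, g))`. -/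
noncomputable def loss [StandardBorelSpace A] [Nonempty A] [SFinite μ] (p : RCPolicy S μ) :
    ℝ≥0∞ :=
  ∫⁻ s, ∫⁻ g, InformationTheory.klDiv (tgt.actionGiven β (s, g)) (p.toKernel (s, g))
    ∂(tgt.returnGivenS β s) ∂(mixOccupancy src tgt β NT NS)

end Oracle

section Assumptions

variable {E : Episode S}

/-- The deterministic policy `π : S → A` has the largest expected return among all policies. -/
def IsOptimal (M : MDP E A) (π : S → A) (hπ : Measurable π) : Prop :=
  ∀ (ρ : Kernel S A) [IsMarkovKernel ρ], M.value ρ ≤ M.value (Kernel.deterministic π hπ)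

/-- The return of `n` steps of the policy `π` from `s` under the noiseless dynamics `(r, T)`. -/
noncomputable def noiselessReturn (r : S → A → ℝ) (T : S → A → S) (π : S → A) : ℕ → S → ℝ
  | 0, _ => 0
  | n + 1, s => r s (π s) + noiselessReturn r T π n (T s (π s))

/-- Return coverage at the initial states, near determinism, and consistency of `f`. -/
structure MDPAssumption (M : MDP E A) (β : Kernel S A) [IsMarkovKernel β] (f : S → ℝ)
    (r : S → A → ℝ) (T : S → A → S) (α ε : ℝ) : Prop where
  init_coverage : ∀ᵐ s ∂M.init, α ≤ (M.returnGivenS β s).real {f s}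
  near_det : ∀ s a, (M.step (s, a)).real {x | x.1 ≠ r s a ∨ x.2 ≠ T s a} ≤ ε
  consistent : ∀ s a, E.time s + 1 < E.H → ∀ᵐ x ∂M.step (s, a), f s = f x.2 + x.1

/-- Bounded occupancy mismatch, return coverage, and overlap of the two domains. -/
structure CoverageAssumption [StandardBorelSpace A] [Nonempty A] (src tgt : MDP E A)
    (β : Kernel S A) [IsMarkovKernel β] (f : S → ℝ) (hf : Measurable f) (C α γ : ℝ) : Prop where
  mismatch : tgt.occupancy (conditionOn (tgt.actionGiven β) f hf) ≤
    ENNReal.ofReal C • tgt.occupancy β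
  coverage : ∀ᵐ s ∂tgt.occupancy (conditionOn (tgt.actionGiven β) f hf),
    α ≤ (tgt.returnGivenS β s).real {f s}
  overlap : tgt.occupancy β ≤ ENNReal.ofReal γ • src.occupancy β

/-- A finite policy class with log-ratios bounded by `c` and approximation error at most
`εapprox`. -/
structure EstimationAssumption [StandardBorelSpace A] [Nonempty A] (src tgt : MDP E A)
    (β : Kernel S A) [IsMarkovKernel β] {μ : Measure A} [SFinite μ] (NT NS : ℕ)
    (P : Finset (RCPolicy S μ)) (c εapprox : ℝ) : Prop where
  pos : ∀ p ∈ P, ∀ s g a, 0 < p.density s g a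
  log_ratio : ∀ p ∈ P, ∀ s g a s' g' a',
    |Real.log (p.density s g a) - Real.log (p.density s' g' a')| ≤ c
  approx : ∃ p ∈ P, loss src tgt β NT NS p ≤ ENNReal.ofReal εapprox

end Assumptions

end RCSL

namespace RCSL

/-! The gap `J(π*) - J(π̂_f)` is split at the mean of `f(s₁)` and at the value of the policy `π_f`
that conditions the true law `P^T_β(a | s, g)` on `g = f(s)`.

From `π*` to `f`: each step deviates from the noiseless dynamics with probability at most `ε` and a
deviation loses at most `H`, so `J(π*)` is at most the mean noiseless return plus `H²ε`, and `f`
dominates the noiseless return (`returnFrom_deterministic_le`). From `f` to `π_f`: consistency makes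
`f` telescope along every transition, so only the last reward can fall short of `f`. By Bayes' rule
and coverage, `π_f` picks an action with the wrong noiseless reward there with probability at most
`ε/α` (`ofReal_le_returnFrom_add`, `lastStep_shortfall_le`).

From `π_f` to `π̂_f`: a performance difference inequality charges `H` times the discrepancy of the
two policies at the states visited by `π_f`. A Pinsker inequality linearized with a free parameter
`l` bounds this discrepancy by `2l + KL/(2l)`. The divergence at `g = f(s)` is at most `1/α` times
its mean over `g`, and the occupancy of `π_f` is transferred to `d^T_β` at cost `C` and then to the
mixture at cost `(N^S+N^T)/(N^S/γ+N^T)`; what remains is the loss `L(π̂)`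
(`lintegral_klDiv_conditionOn_le`).

The loss is controlled by maximum likelihood. Given `(s, a)`, the quantile transform gives
relabelled source returns exactly the target law (`map_quantile_cdf`). Hence differences of the
empirical losses have, after division by `(N^T+N^S)H`, the corresponding differences of `L` as
means. Hoeffding's inequality over independent trajectories and a union bound over `Π` give `L(π̂) ≤
ε_approx + O(c √(log(|Π|/δ)/N))`, with `N = N^T+N^S`; choosing `l` turns this into its square root.
-/

theorem lintegral_const_add {X : Type*} [MeasurableSpace X] (ν : Measure X)
    [IsProbabilityMeasure ν] (c : ℝ≥0∞) (u : X → ℝ≥0∞) : ∫⁻ x, (c + u x) ∂ν = c + ∫⁻ x, u x ∂ν := by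
  rw [lintegral_add_left measurable_const]; simp

variable {S A : Type*} [MeasurableSpace S] [MeasurableSpace A] {E : Episode S}

/-! ### Trajectories: first-step recursions for returns and visits. -/

namespace MDP

/-- First-step analysis: the inductions over the horizon peel off one transition by means of this
identity. -/
theorem lintegral_trajLaw_succ (M : MDP E A) (π : Kernel S A) [IsMarkovKernel π] (n : ℕ) (s : S)
    {F : Traj S A (n + 1) → ℝ≥0∞} (hF : Measurable F) :
    ∫⁻ τ, F τ ∂M.trajLaw π (n + 1) s =
      ∫⁻ a, ∫⁻ x, ∫⁻ τ, F (Fin.cons (s, a, x.1) τ) ∂M.trajLaw π n x.2 ∂M.step (s, a) ∂π s := by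
  have h1 := measurable_cons (S := S) (A := A) n
  have h2 : Measurable fun b : (A × (ℝ × S)) × Traj S A n =>
      F (Fin.cons (s, b.1.1, b.1.2.1) b.2) :=
    hF.comp (h1.comp measurable_prodMk_left)
  rw [trajLaw, Kernel.lintegral_map _ h1 _ hF,
    Kernel.lintegral_id_prod (f := fun z : S × ((A × (ℝ × S)) × Traj S A n) =>
      F (Fin.cons (z.1, z.2.1.1, z.2.1.2.1) z.2.2)) (hF.comp h1)]
  refine (Kernel.lintegral_compProd _ _ _ h2).trans (Kernel.lintegral_compProd π M.step s ?_)
  exact Measurable.lintegral_kernel_prod_right'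
    (κ := ((M.trajLaw π n).comap (fun y : S × (A × (ℝ × S)) => y.2.2.2) (by fun_prop)).comap
      (fun y : A × ℝ × S => (s, y)) (by fun_prop)) h2

theorem ae_trajLaw_succ (M : MDP E A) (π : Kernel S A) [IsMarkovKernel π] (n : ℕ) (s : S)
    {p : Traj S A (n + 1) → Prop} (hp : MeasurableSet {τ | p τ})
    (h : ∀ a, ∀ᵐ x ∂M.step (s, a), ∀ᵐ τ ∂M.trajLaw π n x.2, p (Fin.cons (s, a, x.1) τ)) :
    ∀ᵐ τ ∂M.trajLaw π (n + 1) s, p τ := by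
  rw [ae_iff, ← Set.compl_ofPred, ← lintegral_indicator_one hp.compl, M.lintegral_trajLaw_succ π n s
    (measurable_one.indicator hp.compl)]
  refine (lintegral_congr fun a => ?_).trans lintegral_zero
  rw [lintegral_congr_ae (g := fun _ => 0), lintegral_zero]
  filter_upwards [h a] with x hx
  rw [lintegral_congr_ae (g := fun _ => 0), lintegral_zero]
  filter_upwards [hx] with τ hτ
  exact Set.indicator_of_notMem (by simpa using hτ) _

theorem totalReturn_cons {S A : Type*} {n : ℕ} (x : S × A × ℝ) (τ : Traj S A n) :
    totalReturn (Fin.cons x τ : Traj S A (n + 1)) = x.2.2 + totalReturn τ := by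
  simp [totalReturn, Fin.sum_univ_succ]

theorem returnToGo_cons_zero {S A : Type*} {n : ℕ} (x : S × A × ℝ) (τ : Traj S A n) :
    returnToGo (Fin.cons x τ : Traj S A (n + 1)) 0 = x.2.2 + totalReturn τ := by
  rw [← totalReturn_cons]
  simp only [returnToGo, totalReturn]
  congr 1
  ext i
  simp

theorem returnToGo_cons_succ {S A : Type*} {n : ℕ} (x : S × A × ℝ) (τ : Traj S A n) (h : Fin n) :
    returnToGo (Fin.cons x τ : Traj S A (n + 1)) h.succ = returnToGo τ h := by
  simp only [returnToGo]
  rw [← Fin.map_succEmb_Ici, Finset.sum_map]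
  simp

theorem measurable_returnToGo {n : ℕ} (h : Fin n) :
    Measurable fun τ : Traj S A n => returnToGo τ h := by
  unfold returnToGo; fun_prop

theorem totalReturn_mem (M : MDP E A) (π : Kernel S A) [IsMarkovKernel π] (n : ℕ) (s : S) :
    ∀ᵐ τ ∂M.trajLaw π n s, totalReturn τ ∈ Set.Icc (0 : ℝ) n := by
  induction n generalizing s with
  | zero => exact ae_of_all _ fun τ => by simp [totalReturn]
  | succ n ih =>
    refine M.ae_trajLaw_succ π n s (measurable_totalReturn _ measurableSet_Icc) fun a => ?_
    filter_upwards [M.reward_mem s a] with x hx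
    filter_upwards [ih x.2] with τ hτ
    rw [totalReturn_cons]
    simp only [Set.mem_Icc, Nat.cast_add, Nat.cast_one] at hx hτ ⊢
    constructor <;> linarith

/-- The expected return of `n` steps from a given state, as an extended nonnegative number. -/
noncomputable def returnFrom (M : MDP E A) (π : Kernel S A) [IsMarkovKernel π] (n : ℕ) (s : S) :
    ℝ≥0∞ :=
  ∫⁻ τ, ENNReal.ofReal (totalReturn τ) ∂M.trajLaw π n s

/-- The expected sum of `D` over the states visited in `n` steps from a given state. -/
noncomputable def visitSum (M : MDP E A) (π : Kernel S A) [IsMarkovKernel π] (D : S → ℝ≥0∞)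
    (n : ℕ) (s : S) : ℝ≥0∞ :=
  ∫⁻ τ, ∑ h, D (τ h).1 ∂M.trajLaw π n s

section
variable (M : MDP E A) (π : Kernel S A) [IsMarkovKernel π] (n : ℕ) (s : S)

@[fun_prop]
theorem measurable_returnFrom : Measurable (M.returnFrom π n) :=
  (measurable_totalReturn n).ennreal_ofReal.lintegral_kernel

theorem measurable_visitSum {D : S → ℝ≥0∞} (hD : Measurable D) :
    Measurable (M.visitSum π D n) :=
  Measurable.lintegral_kernel (by fun_prop)

theorem returnFrom_succ :
    M.returnFrom π (n + 1) s =
      ∫⁻ a, ∫⁻ x, (ENNReal.ofReal x.1 + M.returnFrom π n x.2) ∂M.step (s, a) ∂π s := by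
  rw [returnFrom, M.lintegral_trajLaw_succ π n s (measurable_totalReturn _).ennreal_ofReal]
  refine lintegral_congr fun a => lintegral_congr_ae ?_
  filter_upwards [M.reward_mem s a] with x hx
  rw [lintegral_congr_ae (g := fun τ => ENNReal.ofReal x.1 +
    ENNReal.ofReal (totalReturn τ)), lintegral_const_add, ← returnFrom]
  · filter_upwards [M.totalReturn_mem π n x.2] with τ hτ
    rw [totalReturn_cons, ENNReal.ofReal_add hx.1 hτ.1]

theorem returnFrom_le : M.returnFrom π n s ≤ n := by
  calc M.returnFrom π n s ≤ ∫⁻ _, n ∂M.trajLaw π n s := by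
        refine lintegral_mono_ae ?_
        filter_upwards [M.totalReturn_mem π n s] with τ hτ
        exact ENNReal.ofReal_le_of_le_toReal (by simpa using hτ.2)
    _ = n := by simp

theorem visitSum_succ {D : S → ℝ≥0∞} (hD : Measurable D) :
    M.visitSum π D (n + 1) s =
      D s + ∫⁻ a, ∫⁻ x, M.visitSum π D n x.2 ∂M.step (s, a) ∂π s := by
  rw [visitSum, M.lintegral_trajLaw_succ π n s (by fun_prop)]
  have hm := M.measurable_visitSum π n hD
  simp only [Fin.sum_univ_succ, Fin.cons_zero, Fin.cons_succ]
  have : ∀ x : ℝ × S, ∫⁻ τ, (D s + ∑ i, D (τ i).1) ∂M.trajLaw π n x.2 =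
      D s + M.visitSum π D n x.2 := fun x =>
    lintegral_const_add _ _ _
  simp_rw [this]
  have : ∀ a : A, ∫⁻ x, (D s + M.visitSum π D n x.2) ∂M.step (s, a) =
      D s + ∫⁻ x, M.visitSum π D n x.2 ∂M.step (s, a) := fun a =>
    lintegral_const_add _ _ _
  simp_rw [this]
  rw [lintegral_const_add]

end

/-! ### Comparison of returns: change of policy, transition noise, telescoping of `f`. -/

theorem measurable_step_lintegral (M : MDP E A) {F : ℝ × S → ℝ≥0∞} (hF : Measurable F) (s : S) :
    Measurable fun a => ∫⁻ x, F x ∂M.step (s, a) :=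
  (Measurable.lintegral_kernel (κ := M.step) hF).comp (by fun_prop : Measurable fun a => (s, a))

/-- A performance difference inequality: if the expectations of functions with values in `[0, 1]`
under the two policies differ by at most `D`, the returns differ by at most `n` times the
accumulated value of `D`. -/
theorem returnFrom_le_returnFrom_add (M : MDP E A) (π π' : Kernel S A) [IsMarkovKernel π]
    [IsMarkovKernel π'] {D : S → ℝ≥0∞} (hD : Measurable D)
    (h : ∀ s (u : A → ℝ≥0∞), Measurable u → (∀ a, u a ≤ 1) →
      ∫⁻ a, u a ∂π s ≤ ∫⁻ a, u a ∂π' s + D s) (n m : ℕ) (hnm : n ≤ m) (s : S) :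
    M.returnFrom π n s ≤ M.returnFrom π' n s + m * M.visitSum π D n s := by
  induction n generalizing s with
  | zero => simp [returnFrom, totalReturn]
  | succ n ih =>
    have hm := M.measurable_visitSum π n hD
    have hr' := M.measurable_returnFrom π' n
    -- `v a` plays `a` once and then follows `π'`. The policies are thus compared at one state at a
    -- time, and these states are visited by `π`, so only the occupancy of `π` enters.
    set v : A → ℝ≥0∞ := fun a => ∫⁻ x, (ENNReal.ofReal x.1 + M.returnFrom π' n x.2) ∂M.step (s, a)
    have hv : Measurable v := M.measurable_step_lintegral (by fun_prop) s
    have hvm : ∀ a, v a ≤ m := fun a => by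
      calc v a ≤ ∫⁻ _, m ∂M.step (s, a) := by
            refine lintegral_mono_ae ?_
            filter_upwards [M.reward_mem s a] with x hx
            calc _ ≤ (1 : ℝ≥0∞) + n := by
                  gcongr
                  · simpa using hx.2
                  · exact M.returnFrom_le π' n x.2
              _ ≤ m := by rw [add_comm]; exact_mod_cast hnm
        _ = m := by simp
    have hm0 : (m : ℝ≥0∞) ≠ 0 := by simp; omega
    have hmt : (m : ℝ≥0∞) ≠ ⊤ := by simp
    -- The hypothesis tests functions with values at most `1`; rescaling `v ≤ m` produces the factor
    -- `m`.
    have key : ∫⁻ a, v a ∂π s ≤ ∫⁻ a, v a ∂π' s + m * D s := by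
      have := h s (fun a => (m : ℝ≥0∞)⁻¹ * v a) (by fun_prop) fun a => by
        rw [← ENNReal.inv_mul_cancel hm0 hmt]; gcongr; exact hvm a
      rw [lintegral_const_mul _ hv, lintegral_const_mul _ hv] at this
      calc ∫⁻ a, v a ∂π s = m * ((m : ℝ≥0∞)⁻¹ * ∫⁻ a, v a ∂π s) := by
            rw [← mul_assoc, ENNReal.mul_inv_cancel hm0 hmt, one_mul]
        _ ≤ m * ((m : ℝ≥0∞)⁻¹ * ∫⁻ a, v a ∂π' s + D s) := by gcongr
        _ = _ := by rw [mul_add, ← mul_assoc, ENNReal.mul_inv_cancel hm0 hmt, one_mul]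
    rw [returnFrom_succ, returnFrom_succ, M.visitSum_succ π n s hD]
    calc ∫⁻ a, ∫⁻ x, (ENNReal.ofReal x.1 + M.returnFrom π n x.2) ∂M.step (s, a) ∂π s
        ≤ ∫⁻ a, ∫⁻ x, ((ENNReal.ofReal x.1 + M.returnFrom π' n x.2) +
            m * M.visitSum π D n x.2) ∂M.step (s, a) ∂π s := by
          refine lintegral_mono fun a => lintegral_mono fun x => ?_
          rw [add_assoc]
          exact add_le_add_right (ih (by omega) x.2) _
      _ = ∫⁻ a, v a ∂π s + m * ∫⁻ a, ∫⁻ x, M.visitSum π D n x.2 ∂M.step (s, a) ∂π s := by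
          rw [← lintegral_const_mul _ (M.measurable_step_lintegral (by fun_prop) s),
            ← lintegral_add_left hv]
          refine lintegral_congr fun a => ?_
          rw [lintegral_add_left (by fun_prop), lintegral_const_mul _ (by fun_prop)]
      _ ≤ (∫⁻ a, v a ∂π' s + m * D s) +
            m * ∫⁻ a, ∫⁻ x, M.visitSum π D n x.2 ∂M.step (s, a) ∂π s := by gcongr
      _ = _ := by ring

/-- Under near determinism, the return of a deterministic policy is at most the noiseless one, up
to the probability of a deviation in one of the steps. -/
theorem returnFrom_deterministic_le [MeasurableSingletonClass S] (M : MDP E A) {r : S → A → ℝ}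
    {T : S → A → S} {π : S → A} (hπ : Measurable π) {ε : ℝ≥0∞}
    (hε : ∀ s a, M.step (s, a) {x | x.1 ≠ r s a ∨ x.2 ≠ T s a} ≤ ε) (n m : ℕ) (hnm : n ≤ m)
    (s : S) :
    M.returnFrom (Kernel.deterministic π hπ) n s ≤
      ENNReal.ofReal (noiselessReturn r T π n s) + n * (m * ε) := by
  -- For `1 ≤ ε` the error term is at least the maximal return `n`. For `ε < 1` the reward equals `r
  -- s a` with positive probability, so `r` is nonnegative and `ENNReal.ofReal` splits over the
  -- noiseless sum.
  rcases le_or_gt 1 ε with h1 | h1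
  · refine (M.returnFrom_le _ n s).trans (le_add_left ?_)
    rcases Nat.eq_zero_or_pos n with rfl | hn
    · simp
    · have : (1 : ℝ≥0∞) ≤ m := by exact_mod_cast hn.trans_le hnm
      calc (n : ℝ≥0∞) = n * (1 * 1) := by ring
        _ ≤ _ := by gcongr
  induction n generalizing s with
  | zero => simp [returnFrom, totalReturn]
  | succ n ih =>
    let ρ := Kernel.deterministic π hπ
    set B : Set (ℝ × S) := {x | x.1 ≠ r s (π s) ∨ x.2 ≠ T s (π s)}
    have hB : MeasurableSet B := by
      have h1 : MeasurableSet {x : ℝ × S | x.1 ≠ r s (π s)} :=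
        (measurable_fst (measurableSet_singleton _)).compl
      have h2 : MeasurableSet {x : ℝ × S | x.2 ≠ T s (π s)} :=
        (measurable_snd (measurableSet_singleton _)).compl
      exact h1.union h2
    have hstep : Measurable fun a => ∫⁻ x, (ENNReal.ofReal x.1 + M.returnFrom ρ n x.2)
        ∂M.step (s, a) := M.measurable_step_lintegral (by fun_prop) s
    rw [returnFrom_succ, Kernel.deterministic_apply, lintegral_dirac' _ hstep]
    have hr0 : ∀ s a, 0 ≤ r s a := fun s a => by
      by_contra! hneg
      have : M.step (s, a) {x | x.1 ≠ r s a ∨ x.2 ≠ T s a} = 1 := by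
        rw [← measure_univ (μ := M.step (s, a))]
        refine measure_congr ?_
        filter_upwards [M.reward_mem s a] with x hx
        refine propext ⟨fun _ => trivial, fun _ => Or.inl ?_⟩
        have := hx.1
        exact fun h => by linarith
      exact absurd (hε s a) (by rw [this]; exact not_le.2 h1)
    have hnl : ∀ k s, 0 ≤ noiselessReturn r T π k s := fun k => by
      induction k with
      | zero => exact fun _ => le_rfl
      | succ k ihk => exact fun s => add_nonneg (hr0 _ _) (ihk _)
    -- Off the deviation set `B` the transition is noiseless and the induction hypothesis applies;
    -- on `B` the whole remaining return, at most `m`, is charged.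
    calc ∫⁻ x, (ENNReal.ofReal x.1 + M.returnFrom ρ n x.2) ∂M.step (s, π s)
        ≤ ∫⁻ x, ((ENNReal.ofReal (noiselessReturn r T π (n + 1) s) + n * (m * ε)) +
            B.indicator (fun _ => (m : ℝ≥0∞)) x) ∂M.step (s, π s) := by
          refine lintegral_mono_ae ?_
          filter_upwards [M.reward_mem s (π s)] with x hx
          by_cases hxB : x ∈ B
          · rw [Set.indicator_of_mem hxB]
            refine le_add_left ?_
            calc _ ≤ (1 : ℝ≥0∞) + n :=
                  add_le_add (by simpa using hx.2) (M.returnFrom_le ρ n x.2)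
              _ ≤ m := by rw [add_comm]; exact_mod_cast hnm
          · rw [Set.indicator_of_notMem hxB, add_zero]
            simp only [B, Set.mem_ofPred_eq, not_or, not_not] at hxB
            rw [noiselessReturn, ENNReal.ofReal_add (hr0 _ _) (hnl _ _), hxB.1, hxB.2, add_assoc]
            exact add_le_add_right (ih (by omega) _) _
      _ ≤ ENNReal.ofReal (noiselessReturn r T π (n + 1) s) + n * (m * ε) + m * ε := by
          rw [lintegral_const_add, lintegral_indicator_const hB]
          gcongr
          exact hε s (π s)
      _ = _ := by push_cast; ring

/-- If `f` is consistent with the transitions, then the return is at least `f` up to the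
amount by which the last reward falls short of `f`. -/
theorem ofReal_le_returnFrom_add (M : MDP E A) (π : Kernel S A) [IsMarkovKernel π] {f : S → ℝ}
    (hcons : ∀ s a, E.time s + 1 < E.H → ∀ᵐ x ∂M.step (s, a), f s = f x.2 + x.1)
    {D : S → ℝ≥0∞} (hD : Measurable D)
    (hlast : ∀ s, E.time s + 1 = E.H →
      ∫⁻ a, ∫⁻ x, ENNReal.ofReal (f s - x.1) ∂M.step (s, a) ∂π s ≤ D s) (n : ℕ) (s : S)
    (hs : E.time s + (n + 1) = E.H) :
    ENNReal.ofReal (f s) ≤ M.returnFrom π (n + 1) s + M.visitSum π D (n + 1) s := by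
  have aux : ∀ u : A → ℝ × S → ℝ≥0∞, (∀ a, ∀ᵐ x ∂M.step (s, a), ENNReal.ofReal (f s) ≤ u a x) →
      ENNReal.ofReal (f s) ≤ ∫⁻ a, ∫⁻ x, u a x ∂M.step (s, a) ∂π s := fun u hu => by
    calc ENNReal.ofReal (f s) = ∫⁻ a, ∫⁻ x, ENNReal.ofReal (f s) ∂M.step (s, a) ∂π s := by simp
      _ ≤ _ := lintegral_mono fun a => lintegral_mono_ae (hu a)
  -- In the inductive step consistency transfers `f` to the next state without loss, whatever the
  -- policy. The error arises only in the base case, the last time step, where `hlast` charges the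
  -- shortfall to `D`.
  induction n generalizing s with
  | zero =>
    have h0 : ∀ s, M.returnFrom π 0 s = 0 := by simp [returnFrom, totalReturn]
    rw [returnFrom_succ, M.visitSum_succ π 0 s hD]
    simp only [h0, add_zero]
    calc ENNReal.ofReal (f s) ≤ ∫⁻ a, ∫⁻ x, (ENNReal.ofReal x.1 + ENNReal.ofReal (f s - x.1))
            ∂M.step (s, a) ∂π s := by
          refine aux _ fun a => ae_of_all _ fun x => ?_
          calc ENNReal.ofReal (f s) = ENNReal.ofReal (x.1 + (f s - x.1)) := by congr 1; ring
            _ ≤ _ := ENNReal.ofReal_add_le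
      _ = ∫⁻ a, ∫⁻ x, ENNReal.ofReal x.1 ∂M.step (s, a) ∂π s +
            ∫⁻ a, ∫⁻ x, ENNReal.ofReal (f s - x.1) ∂M.step (s, a) ∂π s := by
          rw [← lintegral_add_left (M.measurable_step_lintegral (by fun_prop) s)]
          refine lintegral_congr fun a => ?_
          rw [lintegral_add_left (by fun_prop)]
      _ ≤ _ := add_le_add_right ((hlast s (by omega)).trans le_self_add) _
  | succ n ih =>
    rw [returnFrom_succ, M.visitSum_succ π (n + 1) s hD]
    have hm := M.measurable_visitSum π (n + 1) hD
    have hr' := M.measurable_returnFrom π (n + 1)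
    calc ENNReal.ofReal (f s) ≤ ∫⁻ a, ∫⁻ x, (ENNReal.ofReal x.1 + M.returnFrom π (n + 1) x.2 +
            M.visitSum π D (n + 1) x.2) ∂M.step (s, a) ∂π s := by
          refine aux _ fun a => ?_
          filter_upwards [hcons s a (by omega), M.time_step s a (by omega)] with x hx hxt
          calc ENNReal.ofReal (f s) = ENNReal.ofReal (x.1 + f x.2) := by rw [hx, add_comm]
            _ ≤ ENNReal.ofReal x.1 + ENNReal.ofReal (f x.2) := ENNReal.ofReal_add_le
            _ ≤ _ := by
              rw [add_assoc]
              exact add_le_add_right (ih x.2 (by omega)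
                (fun u hu => by
                  calc ENNReal.ofReal (f x.2)
                      = ∫⁻ a, ∫⁻ _, ENNReal.ofReal (f x.2) ∂M.step (x.2, a) ∂π x.2 := by simp
                    _ ≤ _ := lintegral_mono fun a => lintegral_mono_ae (hu a))) _
      _ = ∫⁻ a, ∫⁻ x, (ENNReal.ofReal x.1 + M.returnFrom π (n + 1) x.2) ∂M.step (s, a) ∂π s +
            ∫⁻ a, ∫⁻ x, M.visitSum π D (n + 1) x.2 ∂M.step (s, a) ∂π s := by
          rw [← lintegral_add_left (M.measurable_step_lintegral (by fun_prop) s)]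
          refine lintegral_congr fun a => ?_
          rw [lintegral_add_left (by fun_prop)]
      _ ≤ _ := add_le_add_right le_add_self _

end MDP

/-- The sum of a function of state, action and return-to-go along a trajectory. -/
noncomputable def trajSum {S A β : Type*} [AddCommMonoid β] (F : S × A × ℝ → β) {n : ℕ}
    (τ : Traj S A n) : β :=
  ∑ h, F ((τ h).1, (τ h).2.1, returnToGo τ h)

theorem measurable_trajSum {β : Type*} [AddCommMonoid β] [MeasurableSpace β]
    [MeasurableAdd₂ β] {F : S × A × ℝ → β} (hF : Measurable F) (n : ℕ) :
    Measurable fun τ : Traj S A n => trajSum F τ := by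
  have := fun h : Fin n => MDP.measurable_returnToGo (S := S) (A := A) h
  unfold trajSum; fun_prop

/-! ### Occupancies and the law of the return-to-go. -/

namespace MDP

section
variable (M : MDP E A) (π : Kernel S A) [IsMarkovKernel π]

instance instProbTrajMeasure : IsProbabilityMeasure (M.trajMeasure π) := by
  rw [trajMeasure]; infer_instance

theorem lintegral_trajMeasure (M : MDP E A) (π : Kernel S A) {F : Traj S A E.H → ℝ≥0∞} (hF : Measurable F) :
    ∫⁻ τ, F τ ∂M.trajMeasure π = ∫⁻ s, ∫⁻ τ, F τ ∂M.trajLaw π E.H s ∂M.init := by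
  rw [trajMeasure, Measure.lintegral_bind (M.trajLaw π E.H).measurable.aemeasurable hF.aemeasurable]

theorem lintegral_visitSum {D : S → ℝ≥0∞} (hD : Measurable D) (hH : E.H ≠ 0) :
    ∫⁻ s, M.visitSum π D E.H s ∂M.init = E.H * ∫⁻ s, D s ∂M.occupancy π := by
  have h0 : (E.H : ℝ≥0∞) ≠ 0 := by exact_mod_cast hH
  rw [occupancy, lintegral_smul_measure, smul_eq_mul, ← mul_assoc,
    ENNReal.mul_inv_cancel h0 (by simp), one_mul, lintegral_finsetSum_measure]
  have : ∀ h : Fin E.H, ∫⁻ s, D s ∂(M.trajMeasure π).map (fun τ => (τ h).1) =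
      ∫⁻ τ, D (τ h).1 ∂M.trajMeasure π := fun h => lintegral_map hD (by fun_prop)
  simp_rw [this]
  rw [← lintegral_finsetSum _ (by fun_prop), lintegral_trajMeasure _ _ (by fun_prop)]
  rfl

theorem isProbabilityMeasure_occupancy (hH : E.H ≠ 0) :
    IsProbabilityMeasure (M.occupancy π) := by
  have h0 : (E.H : ℝ≥0∞) ≠ 0 := by exact_mod_cast hH
  have h := M.lintegral_visitSum π (D := fun _ => 1) measurable_const hH
  simp only [visitSum, Finset.sum_const, Finset.card_univ, Fintype.card_fin, nsmul_eq_mul, mul_one,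
    lintegral_const, measure_univ, one_mul] at h
  refine ⟨?_⟩
  calc M.occupancy π Set.univ = (E.H : ℝ≥0∞)⁻¹ * (E.H * M.occupancy π Set.univ) := by
        rw [← mul_assoc, ENNReal.inv_mul_cancel h0 (by simp), one_mul]
    _ = 1 := by rw [← h, ENNReal.inv_mul_cancel h0 (by simp)]

theorem lintegral_returnFrom_le : ∫⁻ s, M.returnFrom π E.H s ∂M.init ≤ E.H :=
  (lintegral_mono fun s => M.returnFrom_le π E.H s).trans (by simp)

theorem value_eq : M.value π = (∫⁻ s, M.returnFrom π E.H s ∂M.init).toReal := by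
  have hm := measurable_totalReturn (S := S) (A := A) E.H
  have hnn : ∀ᵐ τ ∂M.trajMeasure π, 0 ≤ totalReturn τ := by
    have hs : MeasurableSet {τ : Traj S A E.H | 0 ≤ totalReturn τ} := measurableSet_le
      measurable_const hm
    rw [ae_iff, ← Set.compl_ofPred, ← lintegral_indicator_one hs.compl,
      M.lintegral_trajMeasure π (measurable_one.indicator hs.compl)]
    simp_rw [lintegral_indicator_one hs.compl]
    refine (lintegral_congr fun s => ?_).trans lintegral_zero
    exact ae_iff.1 ((M.totalReturn_mem π E.H s).mono fun τ h => h.1)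
  rw [value, integral_eq_lintegral_of_nonneg_ae hnn hm.aestronglyMeasurable,
    M.lintegral_trajMeasure π hm.ennreal_ofReal]
  rfl

theorem lintegral_stepReturn (n : ℕ) (s : S) (a : A) {G : ℝ → ℝ≥0∞} (hG : Measurable G) :
    ∫⁻ g, G g ∂M.stepReturn π n (s, a) =
      ∫⁻ x, ∫⁻ τ, G (x.1 + totalReturn τ) ∂M.trajLaw π n x.2 ∂M.step (s, a) := by
  have hm := measurable_totalReturn (S := S) (A := A) n
  have := Kernel.IsMarkovKernel.map (M.trajLaw π n) hm
  rw [stepReturn, Kernel.lintegral_map _ (by fun_prop) _ hG,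
    Kernel.lintegral_compProd _ _ _ (by fun_prop)]
  refine lintegral_congr fun x => ?_
  rw [Kernel.lintegral_comap, Kernel.lintegral_map _ hm _ (by fun_prop)]

theorem lintegral_returnGivenSA (s : S) (a : A) {G : ℝ → ℝ≥0∞} (hG : Measurable G) :
    ∫⁻ g, G g ∂M.returnGivenSA π (s, a) =
      ∫⁻ x, ∫⁻ τ, G (x.1 + totalReturn τ) ∂M.trajLaw π (E.H - (E.time s + 1)) x.2
        ∂M.step (s, a) :=
  M.lintegral_stepReturn π _ s a hG

theorem lintegral_returnAction (s : S) {G : ℝ × A → ℝ≥0∞} (hG : Measurable G) :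
    ∫⁻ x, G x ∂M.returnAction π s = ∫⁻ a, ∫⁻ g, G (g, a) ∂M.returnGivenSA π (s, a) ∂π s := by
  rw [returnAction, Kernel.lintegral_swapRight _ _ hG]
  exact Kernel.lintegral_compProd _ _ _ (hG.comp measurable_swap)

theorem measurable_lintegral_returnGivenSA {F : S × A × ℝ → ℝ≥0∞} (hF : Measurable F) :
    Measurable fun s => ∫⁻ a, ∫⁻ g, F (s, a, g) ∂M.returnGivenSA π (s, a) ∂π s := by
  refine Measurable.lintegral_kernel_prod_right' (κ := π)
    (f := fun y : S × A => ∫⁻ g, F (y.1, y.2, g) ∂M.returnGivenSA π (y.1, y.2)) ?_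
  exact Measurable.lintegral_kernel_prod_right' (κ := M.returnGivenSA π)
    (f := fun y : (S × A) × ℝ => F (y.1.1, y.1.2, y.2)) (by fun_prop)

/-- By `hs` the number of remaining steps agrees with the one that `returnGivenSA` reads off the
clock, so this kernel is the conditional law of the return-to-go observed along the trajectory. This
links data sums to occupancies. -/
theorem lintegral_trajSum_trajLaw {F : S × A × ℝ → ℝ≥0∞} (hF : Measurable F) (n : ℕ) (s : S)
    (hs : E.time s + n = E.H) :
    ∫⁻ τ, trajSum F τ ∂M.trajLaw π n s =
      M.visitSum π (fun s => ∫⁻ a, ∫⁻ g, F (s, a, g) ∂M.returnGivenSA π (s, a) ∂π s) n s := by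
  induction n generalizing s with
  | zero => simp [trajSum, visitSum]
  | succ n ih =>
    have hsum := measurable_trajSum hF (S := S) (A := A)
    have htot := measurable_totalReturn (S := S) (A := A) n
    have hn : E.H - (E.time s + 1) = n := by omega
    rw [M.lintegral_trajLaw_succ π n s (hsum _), M.visitSum_succ π n s
      (M.measurable_lintegral_returnGivenSA π hF)]
    have h1 : ∀ a, ∫⁻ g, F (s, a, g) ∂M.returnGivenSA π (s, a) =
        ∫⁻ x, ∫⁻ τ, F (s, a, x.1 + totalReturn τ) ∂M.trajLaw π n x.2 ∂M.step (s, a) := fun a => by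
      rw [M.lintegral_returnGivenSA π s a (G := fun g => F (s, a, g)) (by fun_prop), hn]
    have h2 : Measurable fun y : A × ℝ × S =>
        ∫⁻ τ, F (s, y.1, y.2.1 + totalReturn τ) ∂M.trajLaw π n y.2.2 :=
      Measurable.lintegral_kernel_prod_right'
        (κ := (M.trajLaw π n).comap (fun y : A × (ℝ × S) => y.2.2) (by fun_prop))
        (f := fun z : (A × ℝ × S) × Traj S A n => F (s, z.1.1, z.1.2.1 + totalReturn z.2))
        (by fun_prop)
    have h3 : Measurable fun a => ∫⁻ x, ∫⁻ τ, F (s, a, x.1 + totalReturn τ) ∂M.trajLaw π n x.2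
        ∂M.step (s, a) :=
      Measurable.lintegral_kernel_prod_right'
        (κ := M.step.comap (fun a => (s, a)) (by fun_prop)) h2
    simp_rw [h1]
    rw [← lintegral_add_left h3]
    refine lintegral_congr fun a => ?_
    have h4 : Measurable fun x : ℝ × S =>
        ∫⁻ τ, F (s, a, x.1 + totalReturn τ) ∂M.trajLaw π n x.2 := h2.comp measurable_prodMk_left
    rw [← lintegral_add_left h4]
    have hih : ∀ᵐ x ∂M.step (s, a), ∫⁻ τ, trajSum F τ ∂M.trajLaw π n x.2 = M.visitSum π
        (fun s => ∫⁻ a, ∫⁻ g, F (s, a, g) ∂M.returnGivenSA π (s, a) ∂π s) n x.2 := by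
      -- After the last step the clock of the next state is unconstrained, but no summand remains.
      rcases Nat.eq_zero_or_pos n with rfl | hn0
      · exact ae_of_all _ fun x => by simp [trajSum, visitSum]
      · filter_upwards [M.time_step s a (by omega)] with x hx
        exact ih x.2 (by omega)
    refine lintegral_congr_ae ?_
    filter_upwards [hih] with x hx
    rw [← hx, ← lintegral_add_left (by fun_prop)]
    refine lintegral_congr fun τ => ?_
    simp only [trajSum, Fin.sum_univ_succ, Fin.cons_zero, Fin.cons_succ, returnToGo_cons_zero,
      returnToGo_cons_succ]

theorem lintegral_trajSum {F : S × A × ℝ → ℝ≥0∞} (hF : Measurable F) (hH : E.H ≠ 0) :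
    ∫⁻ τ, trajSum F τ ∂M.trajMeasure π =
      E.H * ∫⁻ s, ∫⁻ a, ∫⁻ g, F (s, a, g) ∂M.returnGivenSA π (s, a) ∂π s ∂M.occupancy π := by
  rw [M.lintegral_trajMeasure π (measurable_trajSum hF _),
    ← M.lintegral_visitSum π (M.measurable_lintegral_returnGivenSA π hF) hH]
  refine lintegral_congr_ae ?_
  filter_upwards [M.time_init] with s hs
  exact M.lintegral_trajSum_trajLaw π hF _ s (by omega)

/-- The subtraction truncates: at states past the horizon the kernel still collects one reward, and
the bound is `1`. -/
theorem ae_returnGivenSA_mem (s : S) (a : A) :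
    ∀ᵐ g ∂M.returnGivenSA π (s, a), g ∈ Set.Icc (0 : ℝ) (E.H - (E.time s + 1) + 1 : ℕ) := by
  rw [ae_iff]
  change M.returnGivenSA π (s, a) (Set.Icc (0 : ℝ) (E.H - (E.time s + 1) + 1 : ℕ))ᶜ = 0
  rw [← lintegral_indicator_one measurableSet_Icc.compl, lintegral_returnGivenSA _ _ _ _
    (measurable_one.indicator measurableSet_Icc.compl)]
  rw [lintegral_congr_ae (g := fun _ => 0), lintegral_zero]
  filter_upwards [M.reward_mem s a] with x hx
  rw [lintegral_congr_ae (g := fun _ => 0), lintegral_zero]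
  filter_upwards [M.totalReturn_mem π _ x.2] with τ hτ
  refine Set.indicator_of_notMem (Set.notMem_compl_iff.2 ?_) _
  simp only [Set.mem_Icc, Nat.cast_add, Nat.cast_one] at hx hτ ⊢
  constructor <;> linarith

end

/-! ### Conditioning the behavior policy on a return. -/

section Conditioning

variable [StandardBorelSpace A] [Nonempty A] (M : MDP E A) (β : Kernel S A) [IsMarkovKernel β]

theorem lintegral_actionGiven (s : S) {G : ℝ × A → ℝ≥0∞} (hG : Measurable G) :
    ∫⁻ g, ∫⁻ a, G (g, a) ∂M.actionGiven β (s, g) ∂M.returnGivenS β s =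
      ∫⁻ x, G x ∂M.returnAction β s :=
  lintegral_condKernel (κ := M.returnAction β) hG s

/-- Bayes' rule at the atom `f s`, obtained by testing the disintegration on functions supported on
`g = f s`. In product form it needs no positivity of the atom. -/
theorem lintegral_conditionOn_mul (s : S) (f : S → ℝ) (hf : Measurable f) {u : A → ℝ≥0∞}
    (hu : Measurable u) :
    (∫⁻ a, u a ∂conditionOn (M.actionGiven β) f hf s) * M.returnGivenS β s {f s} =
      ∫⁻ a, u a * M.returnGivenSA β (s, a) {f s} ∂β s := by
  have h1 := M.lintegral_actionGiven β s (G := fun x => Set.indicator {f s} 1 x.1 * u x.2)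
    (((measurable_one.indicator (measurableSet_singleton _)).comp measurable_fst).mul
      (hu.comp measurable_snd))
  have h2 : ∀ g : ℝ, ∫⁻ a, Set.indicator {f s} (1 : ℝ → ℝ≥0∞) g * u a ∂M.actionGiven β (s, g) =
      Set.indicator {f s} (fun g => ∫⁻ a, u a ∂M.actionGiven β (s, g)) g := fun g => by
    by_cases hg : g = f s <;> simp [hg]
  simp_rw [h2] at h1
  rw [lintegral_indicator (measurableSet_singleton _), Measure.restrict_singleton,
    lintegral_smul_measure, lintegral_dirac, M.lintegral_returnAction β s
    (G := fun x => Set.indicator {f s} 1 x.1 * u x.2)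
    (((measurable_one.indicator (measurableSet_singleton _)).comp measurable_fst).mul
      (hu.comp measurable_snd))] at h1
  rw [mul_comm]
  refine Eq.trans h1 (lintegral_congr fun a => ?_)
  dsimp only
  rw [lintegral_mul_const _ (measurable_one.indicator (measurableSet_singleton _)),
    lintegral_indicator_one (measurableSet_singleton _), mul_comm]

/-- At a covered state in the last time step, the policy obtained by conditioning on the return
collects a reward that falls short of `f` only with small probability. -/
theorem lastStep_shortfall_le (s : S) (hs : E.time s + 1 = E.H) (f : S → ℝ) (hf : Measurable f)
    {r : S → A → ℝ} (hr : Measurable (Function.uncurry r)) {α ε : ℝ≥0∞} (hα : α ≠ 0)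
    (hε : ∀ a, M.step (s, a) {x | x.1 ≠ r s a} ≤ ε) (hcov : α ≤ M.returnGivenS β s {f s}) :
    ∫⁻ a, ∫⁻ x, ENNReal.ofReal (f s - x.1) ∂M.step (s, a)
      ∂conditionOn (M.actionGiven β) f hf s ≤ ε + ε / α := by
  have hrs : Measurable (r s) := hr.comp measurable_prodMk_left
  -- No step remains after this one, so the return-to-go is the reward itself.
  have hlast : ∀ a, M.returnGivenSA β (s, a) {f s} = M.step (s, a) {x | x.1 = f s} := fun a => by
    rw [← lintegral_indicator_one (measurableSet_singleton _), lintegral_returnGivenSA _ _ _ _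
      (measurable_one.indicator (measurableSet_singleton _)), hs, Nat.sub_self]
    have : ∀ τ : Traj S A 0, totalReturn τ = 0 := by simp [totalReturn]
    simp only [this, add_zero, lintegral_const, measure_univ, mul_one]
    have hms : MeasurableSet {x : ℝ × S | x.1 = f s} :=
      measurable_fst (measurableSet_singleton (f s))
    rw [← lintegral_indicator_one hms]
    rfl
  have hα' : α ≤ ∫⁻ a, M.step (s, a) {x | x.1 = f s} ∂β s := by
    have := M.lintegral_conditionOn_mul β s f hf (u := fun _ => 1) measurable_const
    simp only [lintegral_const, measure_univ, one_mul, hlast] at this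
    exact hcov.trans this.le
  -- By coverage the return `f s` has positive probability, so it cannot exceed the maximal reward.
  -- The shortfall is therefore at most `1`.
  have hf1 : f s ≤ 1 := by
    by_contra! h1
    refine hα (le_antisymm (hα'.trans ?_) zero_le)
    rw [lintegral_congr (g := fun _ => 0), lintegral_zero]
    intro a
    have := M.reward_mem s a
    rw [← compl_mem_ae_iff]
    filter_upwards [this] with x hx
    intro h
    have h2 : x.1 = f s := h
    linarith [hx.2]
  have hset : MeasurableSet {a | r s a ≠ f s} := (hrs (measurableSet_singleton _)).compl
  set B : Set A := {a | r s a ≠ f s}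
  -- If `r s a = f s`, a shortfall requires reward noise, of probability at most `ε`. The remaining
  -- actions, forming `B`, are charged the full `1`.
  have h1 : ∀ a, ∫⁻ x, ENNReal.ofReal (f s - x.1) ∂M.step (s, a) ≤ ε + B.indicator 1 a := by
    intro a
    have hb : ∀ᵐ x ∂M.step (s, a), ENNReal.ofReal (f s - x.1) ≤
        {x : ℝ × S | x.1 ≠ f s}.indicator 1 x := by
      filter_upwards [M.reward_mem s a] with x hx
      by_cases h : x.1 = f s
      · simp [h]
      · rw [Set.indicator_of_mem (by exact h)]
        simp only [Pi.one_apply, ENNReal.ofReal_le_one]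
        linarith [hx.1]
    have hms : MeasurableSet {x : ℝ × S | x.1 ≠ f s} :=
      (measurable_fst (measurableSet_singleton (f s))).compl
    refine (lintegral_mono_ae hb).trans ?_
    rw [lintegral_indicator_one hms]
    by_cases ha : r s a = f s
    · refine le_add_right ?_
      rw [← ha]
      exact hε a
    · rw [Set.indicator_of_mem (by exact ha)]
      exact le_add_left prob_le_one
  refine (lintegral_mono h1).trans ?_
  rw [lintegral_const_add]
  refine add_le_add_right ?_ _
  rcases eq_or_ne α ⊤ with rfl | hαt
  · exact absurd (top_le_iff.1 (hcov.trans (by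
      have : IsMarkovKernel (M.returnGivenS β) := by rw [returnGivenS]; infer_instance
      exact prob_le_one))) (by simp)
  rw [ENNReal.le_div_iff_mul_le (Or.inl hα) (Or.inl hαt)]
  -- An action in `B` produces the return `f s` only by deviating from `r s a`. Its likelihood is
  -- thus at most `ε`, and Bayes' rule bounds the posterior mass of `B` by `ε / α`.
  calc (∫⁻ a, B.indicator 1 a ∂conditionOn (M.actionGiven β) f hf s) * α
      ≤ (∫⁻ a, B.indicator 1 a ∂conditionOn (M.actionGiven β) f hf s) *
          M.returnGivenS β s {f s} := by gcongr
    _ = ∫⁻ a, B.indicator 1 a * M.returnGivenSA β (s, a) {f s} ∂β s :=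
        M.lintegral_conditionOn_mul β s f hf (measurable_one.indicator hset)
    _ ≤ ∫⁻ _, ε ∂β s := by
        refine lintegral_mono fun a => ?_
        by_cases ha : r s a = f s
        · rw [Set.indicator_of_notMem (by simpa [B] using ha)]; simp
        · rw [Set.indicator_of_mem (by exact ha), hlast]
          simp only [Pi.one_apply, one_mul]
          refine (measure_mono ?_).trans (hε a)
          rintro x (hx : x.1 = f s)
          rw [Set.mem_ofPred_eq, hx]
          exact Ne.symm ha
    _ = ε := by simp

end Conditioning

end MDP
-- Kullback–Leibler divergence: Pinsker's inequality and comparison of densities.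
section Divergence

open InformationTheory

/-- The pointwise form of the bound of the squared Hellinger distance by the divergence; with `y =
√x` it reduces to `1 - 1/y ≤ log y`. -/
theorem sq_sqrt_sub_one_le_klFun {x : ℝ} (hx : 0 ≤ x) : (√x - 1) ^ 2 ≤ klFun x := by
  rcases hx.eq_or_lt with rfl | hx
  · simp [klFun]
  have hy : 0 < √x := Real.sqrt_pos.2 hx
  have hxy : x = √x ^ 2 := (Real.sq_sqrt hx.le).symm
  have hlog : Real.log x = 2 * Real.log √x := by
    conv_lhs => rw [hxy]
    simp
  have h1 : √x - 1 ≤ √x * Real.log √x := by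
    have := mul_le_mul_of_nonneg_left (Real.one_sub_inv_le_log_of_pos hy) hy.le
    rwa [mul_sub, mul_one, mul_inv_cancel₀ hy.ne'] at this
  have h2 := mul_le_mul_of_nonneg_left h1 hy.le
  rw [klFun, hlog]
  nth_rw 2 [hxy]
  nth_rw 4 [hxy]
  nlinarith

/-- Weighted AM–GM applied to `x - 1 = (√x - 1)(√x + 1)`: the first factor is controlled by `klFun
x`, the second by `x + 1`, whose integral is `2` for a density. The weight `l` replaces the square
root in Pinsker's inequality, so the bound integrates over states without Jensen's inequality. -/
theorem le_one_add_klFun {x l : ℝ} (hx : 0 ≤ x) (hl : 0 < l) :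
    x ≤ 1 + l * (x + 1) + 1 / (2 * l) * klFun x := by
  have h := sq_sqrt_sub_one_le_klFun hx
  have hxy := Real.sq_sqrt hx
  have h1 : (√x - 1) ^ 2 / (2 * l) ≤ 1 / (2 * l) * klFun x := by
    rw [div_eq_mul_inv, mul_comm, one_div]; gcongr
  have h2 : (√x + 1) ^ 2 ≤ 2 * (x + 1) := by nlinarith [sq_nonneg (√x - 1)]
  have h3 : x - 1 = (√x - 1) * (√x + 1) := by nlinarith
  have h4 : (√x - 1) * (√x + 1) ≤ l / 2 * (√x + 1) ^ 2 + (√x - 1) ^ 2 / (2 * l) := by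
    have : l / 2 * (√x + 1) ^ 2 + (√x - 1) ^ 2 / (2 * l) - (√x - 1) * (√x + 1) =
        (l * (√x + 1) - (√x - 1)) ^ 2 / (2 * l) := by field_simp; ring
    have h5 : 0 ≤ (l * (√x + 1) - (√x - 1)) ^ 2 / (2 * l) := by positivity
    linarith
  nlinarith

/-- A linearized form of Pinsker's inequality. -/
theorem lintegral_le_add_klDiv {X : Type*} [MeasurableSpace X] (ν p : Measure X)
    [IsProbabilityMeasure ν] [IsProbabilityMeasure p] {u : X → ℝ≥0∞} (hu : Measurable u)
    (hu1 : ∀ x, u x ≤ 1) {l : ℝ} (hl : 0 < l) :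
    ∫⁻ x, u x ∂ν ≤ ∫⁻ x, u x ∂p +
      (ENNReal.ofReal (2 * l) + ENNReal.ofReal (1 / (2 * l)) * klDiv ν p) := by
  have hl0 : ENNReal.ofReal (1 / (2 * l)) ≠ 0 := by
    rw [ne_eq, ENNReal.ofReal_eq_zero, not_le]; positivity
  by_cases hac : ν ≪ p
  swap
  · rw [klDiv_of_not_ac hac, ENNReal.mul_top hl0]; simp
  set φ := ν.rnDeriv p
  have hφ : Measurable φ := ν.measurable_rnDeriv p
  have hφ1 : ∫⁻ x, φ x ∂p = 1 := by
    rw [Measure.lintegral_rnDeriv hac]; simp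
  have hkl : Measurable fun x => ENNReal.ofReal (klFun (φ x).toReal) :=
    (measurable_klFun.comp hφ.ennreal_toReal).ennreal_ofReal
  calc ∫⁻ x, u x ∂ν = ∫⁻ x, φ x * u x ∂p := by
        rw [← lintegral_rnDeriv_mul hac hu.aemeasurable]
    _ ≤ ∫⁻ x, (u x + (ENNReal.ofReal l * (φ x + 1) +
          ENNReal.ofReal (1 / (2 * l)) * ENNReal.ofReal (klFun (φ x).toReal))) ∂p := by
        refine lintegral_mono_ae ?_
        filter_upwards [ν.rnDeriv_lt_top p] with x hx
        have h1 : φ x ≤ 1 + (ENNReal.ofReal l * (φ x + 1) +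
            ENNReal.ofReal (1 / (2 * l)) * ENNReal.ofReal (klFun (φ x).toReal)) := by
          have hx0 : 0 ≤ (φ x).toReal := ENNReal.toReal_nonneg
          have hk := klFun_nonneg hx0
          calc φ x = ENNReal.ofReal (φ x).toReal := (ENNReal.ofReal_toReal hx.ne).symm
            _ ≤ ENNReal.ofReal (1 + (l * ((φ x).toReal + 1) +
                1 / (2 * l) * klFun (φ x).toReal)) := by
              refine ENNReal.ofReal_le_ofReal ?_
              have := le_one_add_klFun hx0 hl
              linarith
            _ = _ := by
              rw [ENNReal.ofReal_add zero_le_one (by positivity),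
                ENNReal.ofReal_add (by positivity) (by positivity),
                ENNReal.ofReal_mul hl.le, ENNReal.ofReal_mul (by positivity),
                ENNReal.ofReal_add hx0 zero_le_one, ENNReal.ofReal_toReal hx.ne]
              simp [φ]
        calc φ x * u x ≤ (1 + (ENNReal.ofReal l * (φ x + 1) +
            ENNReal.ofReal (1 / (2 * l)) * ENNReal.ofReal (klFun (φ x).toReal))) * u x := by
              gcongr
          _ ≤ _ := by
            rw [add_mul, one_mul]
            gcongr
            exact mul_le_of_le_one_right' (hu1 x)
    _ = _ := by
        rw [lintegral_add_left hu, lintegral_add_left (by fun_prop),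
          lintegral_const_mul _ (by fun_prop), lintegral_const_mul _ hkl,
          lintegral_add_left hφ, hφ1, klDiv_eq_lintegral_klFun_of_ac hac]
        simp only [lintegral_one, measure_univ]
        congr 2
        rw [mul_comm (2 : ℝ), ENNReal.ofReal_mul hl.le]
        norm_num

/-- Comparison of the divergences from two densities that are within a bounded ratio. -/
theorem klDiv_withDensity_add_le {X : Type*} [MeasurableSpace X] (ν μ : Measure X)
    [IsProbabilityMeasure ν] [SigmaFinite μ] {d₀ d₁ : X → ℝ} (hd₀ : Measurable d₀)
    (hd₁ : Measurable d₁) (h₀ : ∀ x, 0 < d₀ x) (h₁ : ∀ x, 0 < d₁ x)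
    [IsProbabilityMeasure (μ.withDensity fun x => ENNReal.ofReal (d₀ x))]
    [IsProbabilityMeasure (μ.withDensity fun x => ENNReal.ofReal (d₁ x))] {m : ℝ}
    (hm : ∀ x, |Real.log (d₀ x) - Real.log (d₁ x)| ≤ m) :
    klDiv ν (μ.withDensity fun x => ENNReal.ofReal (d₁ x)) + ENNReal.ofReal m ≤
      klDiv ν (μ.withDensity fun x => ENNReal.ofReal (d₀ x)) +
        ∫⁻ x, ENNReal.ofReal (Real.log (d₀ x) - Real.log (d₁ x) + m) ∂ν := by
  set p₀ := μ.withDensity fun x => ENNReal.ofReal (d₀ x)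
  set p₁ := μ.withDensity fun x => ENNReal.ofReal (d₁ x)
  set w : X → ℝ := fun x => Real.log (d₀ x) - Real.log (d₁ x)
  have hw : Measurable w := by fun_prop
  by_cases htop : klDiv ν p₀ = ⊤
  · simp [htop]
  obtain ⟨hac, hint⟩ := klDiv_ne_top_iff.1 htop
  have hX : Nonempty X := by
    by_contra h
    rw [not_nonempty_iff] at h
    exact IsProbabilityMeasure.ne_zero ν (Measure.eq_zero_of_isEmpty ν)
  have hm0 : 0 ≤ m := (abs_nonneg _).trans (hm hX.some)
  have hp01 : p₀ = p₁.withDensity fun x => ENNReal.ofReal (d₀ x / d₁ x) := by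
    rw [← withDensity_mul _ (by fun_prop) (by fun_prop)]
    refine congrArg μ.withDensity (funext fun x => ?_)
    rw [Pi.mul_apply, ← ENNReal.ofReal_mul (h₁ x).le, mul_div_cancel₀ _ (h₁ x).ne']
  have hac01 : p₀ ≪ p₁ := by rw [hp01]; exact withDensity_absolutelyContinuous _ _
  have hac1 : ν ≪ p₁ := hac.trans hac01
  -- By the chain rule for Radon–Nikodym derivatives the two log-likelihood ratios differ by the
  -- bounded function `w`. The shift by `m` in the statement makes `w + m` nonnegative and avoids
  -- subtraction in `ℝ≥0∞`.
  have hllr : llr ν p₁ =ᵐ[ν] fun x => llr ν p₀ x + w x := by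
    have e1 := hac1.ae_le (Measure.rnDeriv_mul_rnDeriv (κ := p₁) hac)
    have e2 : p₀.rnDeriv p₁ =ᵐ[ν] fun x => ENNReal.ofReal (d₀ x / d₁ x) := by
      refine hac1.ae_le ?_
      rw [hp01]
      exact Measure.rnDeriv_withDensity _ (by fun_prop)
    filter_upwards [e1, e2, Measure.rnDeriv_pos hac, hac.ae_le (Measure.rnDeriv_lt_top ν p₀)]
      with x hx1 hx2 hx3 hx4
    have hd : 0 < d₀ x / d₁ x := div_pos (h₀ x) (h₁ x)
    simp only [llr]
    rw [← hx1, Pi.mul_apply, hx2, ENNReal.toReal_mul, ENNReal.toReal_ofReal hd.le,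
      Real.log_mul (ENNReal.toReal_pos hx3.ne' hx4.ne).ne' hd.ne',
      Real.log_div (h₀ x).ne' (h₁ x).ne']
  have hwint : Integrable w ν :=
    Integrable.of_bound hw.aestronglyMeasurable m (ae_of_all _ fun x => by simpa using hm x)
  have hint1 : Integrable (llr ν p₁) ν := (hint.add hwint).congr hllr.symm
  have hI1 : ∫ x, llr ν p₁ x ∂ν = ∫ x, llr ν p₀ x ∂ν + ∫ x, w x ∂ν := by
    rw [integral_congr_ae hllr, integral_add hint hwint]
  have hk : ∀ p : Measure X, [IsProbabilityMeasure p] → ν ≪ p → Integrable (llr ν p) ν →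
      klDiv ν p = ENNReal.ofReal (∫ x, llr ν p x ∂ν) ∧ 0 ≤ ∫ x, llr ν p x ∂ν := by
    intro p _ h1 h2
    have := integral_llr_add_sub_measure_univ_nonneg h1 h2
    rw [klDiv_of_ac_of_integrable h1 h2]
    simp only [probReal_univ, add_sub_cancel_right] at this ⊢
    exact ⟨trivial, this⟩
  have hW : ∫⁻ x, ENNReal.ofReal (w x + m) ∂ν = ENNReal.ofReal (∫ x, w x ∂ν + m) := by
    have hwm : Integrable (fun x => w x + m) ν := hwint.add (integrable_const m)
    rw [← ofReal_integral_eq_lintegral_ofReal hwm (ae_of_all _ fun x => by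
        have := (abs_le.1 (hm x)).1
        change 0 ≤ w x + m
        linarith)]
    simp [integral_add hwint (integrable_const m)]
  rw [hW, (hk p₁ hac1 hint1).1, (hk p₀ hac hint).1, ← ENNReal.ofReal_add (hk p₁ hac1 hint1).2 hm0,
    hI1, add_assoc]
  exact ENNReal.ofReal_add_le

/-- Absolute continuity is a measurable condition on the parameter, and the kernel derivative is a
jointly measurable version of the pointwise ones. -/
theorem measurable_klDiv_kernel {X Y : Type*} [MeasurableSpace X] [MeasurableSpace Y]
    [MeasurableSpace.CountableOrCountablyGenerated X Y] (κ η : Kernel X Y) [IsFiniteKernel κ]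
    [IsFiniteKernel η] : Measurable fun x => klDiv (κ x) (η x) := by
  classical
  have h : (fun x => klDiv (κ x) (η x)) = fun x => if κ x ≪ η x then
      ∫⁻ y, ENNReal.ofReal (klFun (κ.rnDeriv η x y).toReal) ∂η x else ⊤ := by
    ext x
    rw [klDiv_eq_lintegral_klFun]
    congr 1
    refine lintegral_congr_ae ?_
    filter_upwards [Kernel.rnDeriv_eq_rnDeriv_measure (κ := κ) (η := η) (a := x)] with y hy
    rw [hy]
  rw [h]
  refine Measurable.ite (Kernel.measurableSet_absolutelyContinuous κ η) ?_ measurable_const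
  exact Measurable.lintegral_kernel_prod_right' (κ := η)
    (f := fun y : X × Y => ENNReal.ofReal (klFun (κ.rnDeriv η y.1 y.2).toReal))
    ((measurable_klFun.comp (Kernel.measurable_rnDeriv κ η).ennreal_toReal).ennreal_ofReal)

end Divergence

/-! ### The quantile transform for distribution functions with jumps. -/

section Quantile

open Filter Topology

/-- The event is a lower set. If it is some `Set.Iic x`, its mass is a value of the distribution
function that is at most `q`; an open half-line or the whole line is a limit of such sets. -/
theorem measureReal_cdf_le (ν : Measure ℝ) [IsProbabilityMeasure ν] {q : ℝ} (hq : 0 ≤ q) : ν.real {g | cdf ν g ≤ q} ≤ q := by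
  set B := {g | cdf ν g ≤ q}
  have hlow : ∀ x ∈ B, Set.Iic x ⊆ B := fun x (hx : _ ≤ q) y (hy : y ≤ x) =>
    (monotone_cdf ν hy).trans hx
  by_cases hne : B.Nonempty
  swap
  · rw [Set.not_nonempty_iff_eq_empty.1 hne]; simpa using hq
  by_cases hbdd : BddAbove B
  · by_cases hmem : sSup B ∈ B
    · have : B = Set.Iic (sSup B) :=
        Set.Subset.antisymm (fun x hx => le_csSup hbdd hx) (hlow _ hmem)
      rw [this, ← cdf_eq_real]
      exact hmem
    · have : B = Set.Iio (sSup B) := by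
        refine Set.Subset.antisymm (fun x hx => lt_of_le_of_ne (le_csSup hbdd hx) ?_) ?_
        · rintro rfl; exact hmem hx
        · intro x (hx : x < _)
          obtain ⟨y, hy, hxy⟩ := exists_lt_of_lt_csSup hne hx
          exact hlow y hy hxy.le
      obtain ⟨u, hu, hult, hut⟩ := exists_seq_strictMono_tendsto (sSup B)
      have hU : Set.Iio (sSup B) = ⋃ n, Set.Iic (u n) := by
        ext x
        simp only [Set.mem_Iio, Set.mem_iUnion, Set.mem_Iic]
        constructor
        · intro hx
          exact ((hut.eventually (lt_mem_nhds hx)).exists).imp fun n hn => hn.le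
        · rintro ⟨n, hn⟩; exact hn.trans_lt (hult n)
      have hl : Tendsto (fun n => ν.real (Set.Iic (u n))) atTop (𝓝 (ν.real B)) := by
        rw [this, hU]
        exact (ENNReal.tendsto_toReal (measure_ne_top _ _)).comp
          (tendsto_measure_iUnion_atTop fun i j hij => Set.Iic_subset_Iic.2 (hu.monotone hij))
      refine le_of_tendsto' hl fun n => ?_
      rw [← cdf_eq_real]
      have : u n ∈ B := by rw [this]; exact hult n
      exact this
  · refine (show ν.real B ≤ 1 from measureReal_le_one).trans
      (le_of_tendsto' (tendsto_cdf_atTop ν) fun x => ?_)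
    obtain ⟨y, hy, hxy⟩ := not_bddAbove_iff.1 hbdd x
    exact hlow y hy hxy.le

/-- The event that the distribution function is at most `q` has probability `q` if `q` is a limit
of values of the distribution function. -/
theorem measureReal_cdf_le_eq (ν : Measure ℝ) [IsProbabilityMeasure ν]
    {q : ℝ} (hq : q ∈ closure (Set.range (cdf ν))) :
    ν.real {g | cdf ν g ≤ q} = q := by
  have hq0 : 0 ≤ q := by
    have : closure (Set.range (cdf ν)) ⊆ Set.Ici 0 :=
      closure_minimal (by rintro _ ⟨x, rfl⟩; exact cdf_nonneg ν x) isClosed_Ici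
    exact this hq
  refine le_antisymm (measureReal_cdf_le ν hq0) ?_
  have hge : ∀ x, cdf ν x ≤ q → cdf ν x ≤ ν.real {g | cdf ν g ≤ q} := fun x hx => by
    rw [cdf_eq_real ν x]
    exact measureReal_mono fun y (hy : y ≤ x) => (monotone_cdf ν hy).trans hx
  -- Otherwise the distribution function has no value in `(b, q]`, so `q` is approached from above,
  -- along `U`. Right continuity then gives the value `q` at `sInf U`, inside the gap.
  by_contra! hlt
  set b := ν.real {g | cdf ν g ≤ q}
  have hgap : ∀ x, cdf ν x ≤ q → cdf ν x ≤ b := hge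
  set U := {x | q < cdf ν x}
  have hU : ∀ δ > 0, ∃ x ∈ U, cdf ν x < q + δ := fun δ hδ => by
    rw [Metric.mem_closure_range_iff] at hq
    obtain ⟨x, hx⟩ := hq (min δ (q - b)) (lt_min hδ (by linarith))
    rw [Real.dist_eq, abs_lt] at hx
    have h1 := min_le_left δ (q - b)
    have h2 := min_le_right δ (q - b)
    refine ⟨x, ?_, by linarith⟩
    by_contra h
    have : cdf ν x ≤ q := not_lt.1 h
    linarith [hge x this]
  have hb0 : 0 ≤ b := measureReal_nonneg
  have hbdd : BddBelow U := by
    obtain ⟨x, hx⟩ := ((tendsto_cdf_atBot ν).eventually (gt_mem_nhds (hb0.trans_lt hlt))).exists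
    refine ⟨x, fun y (hy : q < cdf ν y) => ?_⟩
    by_contra! h
    linarith [monotone_cdf ν h.le]
  have hne : U.Nonempty := (hU 1 one_pos).imp fun x hx => hx.1
  have h1 : cdf ν (sInf U) ≤ q := by
    refine le_of_forall_pos_le_add fun δ hδ => ?_
    obtain ⟨x, hx, hx'⟩ := hU δ hδ
    exact (monotone_cdf ν (csInf_le hbdd hx)).trans hx'.le
  have h2 : q ≤ cdf ν (sInf U) := by
    have hr := (cdf ν).right_continuous (sInf U)
    have hr' : Tendsto (cdf ν) (𝓝[>] (sInf U)) (𝓝 (cdf ν (sInf U))) :=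
      hr.mono Set.Ioi_subset_Ici_self
    refine ge_of_tendsto hr' ?_
    filter_upwards [self_mem_nhdsWithin] with x (hx : _ < x)
    obtain ⟨y, hy, hyx⟩ := exists_lt_of_csInf_lt hne hx
    exact (le_of_lt hy).trans (monotone_cdf ν hyx.le)
  linarith [hge _ h1]

/-- Right continuity makes the infimum attained. Positivity of `q` bounds the set from below and
`hex` makes it nonempty. -/
theorem quantile_le_iff (ρ : Measure ℝ) {q y : ℝ} (hq : 0 < q) (hex : ∃ y, q ≤ cdf ρ y) :
    quantile (cdf ρ) q ≤ y ↔ q ≤ cdf ρ y := by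
  have hbdd : BddBelow {y | q ≤ cdf ρ y} := by
    obtain ⟨x, hx⟩ := ((tendsto_cdf_atBot ρ).eventually (gt_mem_nhds hq)).exists
    refine ⟨x, fun y (hy : q ≤ cdf ρ y) => ?_⟩
    by_contra! h
    linarith [monotone_cdf ρ h.le]
  have hmem : q ≤ cdf ρ (sInf {y | q ≤ cdf ρ y}) := by
    have hr := (cdf ρ).right_continuous (sInf {y | q ≤ cdf ρ y})
    have hr' : Tendsto (cdf ρ) (𝓝[>] (sInf {y | q ≤ cdf ρ y}))
      (𝓝 (cdf ρ (sInf {y | q ≤ cdf ρ y}))) := hr.mono Set.Ioi_subset_Ici_self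
    refine ge_of_tendsto hr' ?_
    filter_upwards [self_mem_nhdsWithin] with x (hx : _ < x)
    obtain ⟨y, hy, hyx⟩ := exists_lt_of_csInf_lt hex hx
    exact le_trans hy (monotone_cdf ρ hyx.le)
  exact ⟨fun h => hmem.trans (monotone_cdf ρ h), fun h => csInf_le hbdd h⟩

/-- Here the infimum runs over all reals and `sInf` takes its default value. -/
theorem quantile_zero (ρ : Measure ℝ) : quantile (cdf ρ) 0 = 0 := by
  have : {y | 0 ≤ cdf ρ y} = Set.univ := Set.eq_univ_of_forall fun y => cdf_nonneg ρ y
  rw [quantile, this, Real.sInf_univ]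

/-- The quantile transform: if `ρ` has bounded support and the values of its distribution function
are limits of values of that of `ν`, then `g ↦ G_ρ⁻¹(G_ν(g))` transports `ν` to `ρ`. -/
theorem map_quantile_cdf (ν ρ : Measure ℝ) [IsProbabilityMeasure ν] [IsProbabilityMeasure ρ]
    {m : ℝ} (hm : cdf ρ m = 1)
    (hψ : Measurable fun g => quantile (cdf ρ) (cdf ν g))
    (hνρ : Set.range (cdf ρ) ⊆ closure (Set.range (cdf ν))) :
    ν.map (fun g => quantile (cdf ρ) (cdf ν g)) = ρ := by
  have := Measure.isProbabilityMeasure_map (μ := ν) hψ.aemeasurable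
  refine Measure.ext_of_Iic _ _ fun y => ?_
  rw [Measure.map_apply hψ measurableSet_Iic]
  have h0 : ν.real {g | cdf ν g ≤ 0} = 0 :=
    le_antisymm (measureReal_cdf_le ν le_rfl) measureReal_nonneg
  have h1 : ν {g | cdf ν g ≤ 0} = 0 := (measureReal_eq_zero_iff).1 h0
  -- The events agree by `quantile_le_iff` off the null set where `cdf ν` vanishes. Bounded support
  -- of `ρ` covers the level `1`.
  have h2 : ν ((fun g => quantile (cdf ρ) (cdf ν g)) ⁻¹' Set.Iic y) =
      ν {g | cdf ν g ≤ cdf ρ y} := by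
    refine measure_congr ?_
    have : ∀ᵐ g ∂ν, 0 < cdf ν g := by
      rw [ae_iff]; simpa using h1
    filter_upwards [this] with g hg
    exact propext (quantile_le_iff ρ hg ⟨m, hm ▸ cdf_le_one ν g⟩)
  rw [h2, ← ENNReal.toReal_eq_toReal_iff' (measure_ne_top _ _) (measure_ne_top _ _)]
  exact (measureReal_cdf_le_eq ν (hνρ ⟨y, rfl⟩)).trans (cdf_eq_real ρ y)

end Quantile

/-! ### The relabelling oracle: measurability and transport of the return law. -/

section Relabel

variable {S A : Type*} [MeasurableSpace S] [MeasurableSpace A] {E : Episode S}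
  (β : Kernel S A) [IsMarkovKernel β]

theorem measurable_returnCDF (M : MDP E A) :
    Measurable fun x : S × A × ℝ => returnCDF β M x.1 x.2.1 x.2.2 := by
  have h : Measurable fun x : S × A × ℝ => M.returnGivenSA β (x.1, x.2.1) (Set.Iic x.2.2) :=
    Kernel.measurable_kernel_prodMk_left
      (κ := (M.returnGivenSA β).comap (fun x : S × A × ℝ => (x.1, x.2.1)) (by fun_prop))
      (t := {z : (S × A × ℝ) × ℝ | z.2 ≤ z.1.2.2})
      (measurableSet_le (by fun_prop) (by fun_prop))
  simp only [returnCDF, cdf_eq_real]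
  exact h.ennreal_toReal

theorem exists_returnCDF_eq_one (M : MDP E A) (s : S) (a : A) :
    ∃ m : ℝ, returnCDF β M s a m = 1 := by
  refine ⟨(E.H - (E.time s + 1) + 1 : ℕ), ?_⟩
  rw [returnCDF, cdf_eq_real, measureReal_def, measure_congr (t := Set.univ), measure_univ, ENNReal.toReal_one]
  filter_upwards [M.ae_returnGivenSA_mem β s a] with g hg
  exact propext ⟨fun _ => trivial, fun _ => hg.2⟩

theorem measurable_relabel (src tgt : MDP E A) :
    Measurable fun x : S × A × ℝ => relabel src tgt β x.1 x.2.1 x.2.2 := by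
  have hs := measurable_returnCDF β src
  have ht := measurable_returnCDF β tgt
  have hp : MeasurableSet {x : S × A × ℝ | 0 < returnCDF β src x.1 x.2.1 x.2.2} :=
    measurableSet_lt measurable_const hs
  classical
  have : (fun x : S × A × ℝ => relabel src tgt β x.1 x.2.1 x.2.2) = fun x =>
      if x ∈ {x : S × A × ℝ | 0 < returnCDF β src x.1 x.2.1 x.2.2} then
        relabel src tgt β x.1 x.2.1 x.2.2 else 0 := by
    ext x
    split_ifs with h
    · rfl
    · have h0 : returnCDF β src x.1 x.2.1 x.2.2 = 0 :=
        le_antisymm (not_lt.1 h) (cdf_nonneg _ _)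
      rw [relabel, h0]
      exact quantile_zero _
  refine measurable_of_Iic fun y => ?_
  rw [this]
  -- Sublevel sets come from `quantile_le_iff` where the source distribution function is positive;
  -- where it vanishes, the default value `0` decides.
  have h2 : (fun x : S × A × ℝ =>
      if x ∈ {x : S × A × ℝ | 0 < returnCDF β src x.1 x.2.1 x.2.2} then
        relabel src tgt β x.1 x.2.1 x.2.2 else 0) ⁻¹' Set.Iic y =
      ({x | 0 < returnCDF β src x.1 x.2.1 x.2.2} ∩
        {x | returnCDF β src x.1 x.2.1 x.2.2 ≤ returnCDF β tgt x.1 x.2.1 y}) ∪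
      ({x | 0 < returnCDF β src x.1 x.2.1 x.2.2}ᶜ ∩ {_x | 0 ≤ y}) := by
    ext x
    by_cases h : x ∈ {x : S × A × ℝ | 0 < returnCDF β src x.1 x.2.1 x.2.2}
    · have hq := quantile_le_iff (tgt.returnGivenSA β (x.1, x.2.1)) (y := y) h
        ((exists_returnCDF_eq_one β tgt x.1 x.2.1).imp fun m hm => by
          change _ ≤ returnCDF β tgt x.1 x.2.1 m
          rw [hm]; exact cdf_le_one _ _)
      simp only [Set.mem_preimage, Set.mem_Iic, Set.mem_union, Set.mem_inter_iff, h,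
        true_and, Set.mem_compl_iff, not_true_eq_false, false_and, or_false]
      exact hq
    · simp only [Set.mem_preimage, Set.mem_Iic, Set.mem_union, Set.mem_inter_iff, h,
        false_and, Set.mem_compl_iff, not_false_eq_true, true_and, false_or]
      rfl
  rw [h2]
  refine (hp.inter (measurableSet_le hs ?_)).union (hp.compl.inter (MeasurableSet.const _))
  exact ht.comp (by fun_prop : Measurable fun x : S × A × ℝ => (x.1, x.2.1, y))

/-- Relabelling turns the source law of the return-to-go into the target law. -/
theorem lintegral_relabel (src tgt : MDP E A) (s : S) (a : A)
    (h : Set.range (returnCDF β tgt s a) ⊆ closure (Set.range (returnCDF β src s a)))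
    {G : ℝ → ℝ≥0∞} (hG : Measurable G) :
    ∫⁻ g, G (relabel src tgt β s a g) ∂src.returnGivenSA β (s, a) =
      ∫⁻ g, G g ∂tgt.returnGivenSA β (s, a) := by
  obtain ⟨m, hm⟩ := exists_returnCDF_eq_one β tgt s a
  have hψ : Measurable fun g => relabel src tgt β s a g :=
    Measurable.comp (f := fun g : ℝ => (s, a, g)) (measurable_relabel β src tgt) (by fun_prop)
  have hmap : (src.returnGivenSA β (s, a)).map (relabel src tgt β s a) =
      tgt.returnGivenSA β (s, a) :=
    map_quantile_cdf (src.returnGivenSA β (s, a)) (tgt.returnGivenSA β (s, a)) hm hψ h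
  rw [← hmap, lintegral_map hG hψ]

end Relabel

/-! ### Hoeffding's inequality for two independent samples. -/

section Concentration

open scoped NNReal

variable {X Y : Type*} [MeasurableSpace X] [MeasurableSpace Y]

theorem hasSubgaussianMGF_sum_pi (P : Measure X) [IsProbabilityMeasure P] {u : X → ℝ}
    (hu : Measurable u) {a b : ℝ} (hab : ∀ x, u x ∈ Set.Icc a b) (n : ℕ) :
    HasSubgaussianMGF (fun D : Fin n → X => ∑ i, (u (D i) - ∫ x, u x ∂P))
      (n * (‖b - a‖₊ / 2) ^ 2) (Measure.pi fun _ : Fin n => P) := by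
  have h1 := hasSubgaussianMGF_of_mem_Icc (μ := P) hu.aemeasurable (ae_of_all _ hab)
  have hind := iIndepFun_pi (μ := fun _ : Fin n => P) (X := fun _ x => u x - ∫ x, u x ∂P)
    fun _ => by fun_prop
  have := HasSubgaussianMGF.sum_of_iIndepFun hind (c := fun _ => (‖b - a‖₊ / 2) ^ 2)
    (s := Finset.univ) fun i _ => by
      refine HasSubgaussianMGF.of_map (Y := fun D : Fin n → X => D i)
        (X := fun x => u x - ∫ x, u x ∂P) (measurable_pi_apply i).aemeasurable ?_
      rw [(measurePreserving_eval (fun _ : Fin n => P) i).map_eq]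
      exact h1
  simpa using this

/-- Hoeffding's inequality for two independent samples. -/
theorem measure_sum_gt_le (P : Measure X) [IsProbabilityMeasure P] (Q : Measure Y)
    [IsProbabilityMeasure Q] {u : X → ℝ} (hu : Measurable u) {v : Y → ℝ} (hv : Measurable v)
    {a b : ℝ} (hab : a ≤ b) (hua : ∀ x, u x ∈ Set.Icc a b) (hva : ∀ x, v x ∈ Set.Icc a b)
    (m n : ℕ) (hmn : 0 < m + n) {L : ℝ} (hL : 0 ≤ L) :
    (Measure.pi fun _ : Fin m => P).prod (Measure.pi fun _ : Fin n => Q)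
      {D | (b - a) * √((m + n) * L / 2) <
        ∑ i, (u (D.1 i) - ∫ x, u x ∂P) + ∑ j, (v (D.2 j) - ∫ x, v x ∂Q)} ≤
      ENNReal.ofReal (Real.exp (-L)) := by
  set PP := (Measure.pi fun _ : Fin m => P).prod (Measure.pi fun _ : Fin n => Q)
  set σ : ℝ≥0 := (‖b - a‖₊ / 2) ^ 2
  have h1 : HasSubgaussianMGF (fun D : (Fin m → X) × (Fin n → Y) =>
      ∑ i, (u (D.1 i) - ∫ x, u x ∂P)) (m * σ) PP := by
    refine HasSubgaussianMGF.of_map (Y := Prod.fst)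
      (X := fun D : Fin m → X => ∑ i, (u (D i) - ∫ x, u x ∂P)) measurable_fst.aemeasurable ?_
    rw [Measure.map_fst_prod, measure_univ, one_smul]
    exact hasSubgaussianMGF_sum_pi P hu hua m
  have h2 : HasSubgaussianMGF (fun D : (Fin m → X) × (Fin n → Y) =>
      ∑ i, (v (D.2 i) - ∫ x, v x ∂Q)) (n * σ) PP := by
    refine HasSubgaussianMGF.of_map (Y := Prod.snd)
      (X := fun D : Fin n → Y => ∑ i, (v (D i) - ∫ x, v x ∂Q)) measurable_snd.aemeasurable ?_
    rw [Measure.map_snd_prod, measure_univ, one_smul]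
    exact hasSubgaussianMGF_sum_pi Q hv hva n
  have h3 := h1.add_of_indepFun h2 (indepFun_prod
    (X := fun D : Fin m → X => ∑ i, (u (D i) - ∫ x, u x ∂P))
    (Y := fun D : Fin n → Y => ∑ i, (v (D i) - ∫ x, v x ∂Q)) (by fun_prop) (by fun_prop))
  -- For `a = b` the Chernoff exponent would divide by zero; the deviation is then almost surely
  -- zero and the strict inequality fails.
  rcases hab.eq_or_lt with rfl | hlt
  · have hσ : m * σ + n * σ = 0 := by simp [σ]
    rw [hσ] at h3
    have h0 := h3.ae_eq_zero_of_hasSubgaussianMGF_zero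
    refine le_of_eq_of_le ?_ zero_le
    rw [← compl_mem_ae_iff]
    filter_upwards [h0] with D hD
    intro hD'
    rw [Set.mem_ofPred_eq, hD, sub_self, zero_mul] at hD'
    exact lt_irrefl _ hD'
  · have hmn' : (0 : ℝ) < m + n := by exact_mod_cast hmn
    have hba : 0 < b - a := sub_pos.2 hlt
    have h4 := h3.measure_ge_le (ε := (b - a) * √((m + n) * L / 2)) (by positivity)
    -- The variance proxies add up to `(m + n)(b - a)²/4`, and the threshold is chosen to make the
    -- exponent exactly `-L`.
    have hexp : -((b - a) * √((m + n) * L / 2)) ^ 2 / (2 * ((m * σ + n * σ : ℝ≥0) : ℝ)) = -L := by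
      rw [mul_pow, Real.sq_sqrt (by positivity)]
      simp only [σ, NNReal.coe_add, NNReal.coe_mul, NNReal.coe_natCast, NNReal.coe_pow,
        NNReal.coe_div, coe_nnnorm, Real.norm_of_nonneg hba.le, NNReal.coe_ofNat]
      field_simp
    rw [hexp] at h4
    rw [← ofReal_measureReal]
    refine ENNReal.ofReal_le_ofReal (le_trans ?_ h4)
    refine measureReal_mono fun D hD => ?_
    rw [Set.mem_ofPred_eq] at hD ⊢
    exact hD.le

end Concentration

/-! ### The mixed occupancy and differences of population losses. -/

section Loss

open InformationTheory

variable {S A : Type*} [MeasurableSpace S] [MeasurableSpace A] {E : Episode S}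
  (src tgt : MDP E A) (β : Kernel S A) [IsMarkovKernel β] {μ : Measure A} (NT NS : ℕ)

theorem natCast_div_eq_ofReal (hN : 0 < NT + NS) (k : ℕ) :
    (k / (NT + NS) : ℝ≥0∞) = ENNReal.ofReal (k / (NT + NS)) := by
  rw [ENNReal.ofReal_div_of_pos (by exact_mod_cast hN),
    ENNReal.ofReal_add (by positivity) (by positivity)]
  simp

theorem lintegral_mixOccupancy (src tgt : MDP E A) (β : Kernel S A) (NT NS : ℕ) (F : S → ℝ≥0∞) :
    ∫⁻ s, F s ∂mixOccupancy src tgt β NT NS =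
      (NT / (NT + NS) : ℝ≥0∞) * ∫⁻ s, F s ∂tgt.occupancy β +
        (NS / (NT + NS) : ℝ≥0∞) * ∫⁻ s, F s ∂src.occupancy β := by
  rw [mixOccupancy, lintegral_add_measure, lintegral_smul_measure, lintegral_smul_measure]
  rfl

theorem isProbabilityMeasure_mixOccupancy (hN : 0 < NT + NS) (hH : E.H ≠ 0) :
    IsProbabilityMeasure (mixOccupancy src tgt β NT NS) := by
  have := tgt.isProbabilityMeasure_occupancy β hH
  have := src.isProbabilityMeasure_occupancy β hH
  refine ⟨?_⟩
  have h := lintegral_mixOccupancy src tgt β NT NS fun _ => 1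
  simp only [lintegral_one, measure_univ, mul_one] at h
  rw [h, ENNReal.div_add_div_same]
  exact ENNReal.div_self (by exact_mod_cast hN.ne') (by finiteness)

/-- The target occupancy is dominated by the mixed occupancy. -/
theorem lintegral_occupancy_le_mix (src tgt : MDP E A) (β : Kernel S A) (NT NS : ℕ) {γ : ℝ} (hγ : 0 < γ) (hN : 0 < NT + NS)
    (hover : tgt.occupancy β ≤ ENNReal.ofReal γ • src.occupancy β) (F : S → ℝ≥0∞) :
    ∫⁻ s, F s ∂tgt.occupancy β ≤
      ENNReal.ofReal (((NS : ℝ) + NT) / (NS / γ + NT)) *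
        ∫⁻ s, F s ∂mixOccupancy src tgt β NT NS := by
  rw [lintegral_mixOccupancy]
  set x := ∫⁻ s, F s ∂tgt.occupancy β
  set y := ∫⁻ s, F s ∂src.occupancy β
  have hxy : x ≤ ENNReal.ofReal γ * y := by
    refine (lintegral_mono' hover le_rfl).trans ?_
    rw [lintegral_smul_measure]; rfl
  have hxy' : ENNReal.ofReal γ⁻¹ * x ≤ y := by
    calc ENNReal.ofReal γ⁻¹ * x ≤ ENNReal.ofReal γ⁻¹ * (ENNReal.ofReal γ * y) := by gcongr
      _ = y := by
        rw [← mul_assoc, ← ENNReal.ofReal_mul (inv_nonneg.2 hγ.le), inv_mul_cancel₀ hγ.ne']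
        simp
  have hNr : (0 : ℝ) < NT + NS := by exact_mod_cast hN
  have hden : 0 < (NS : ℝ) / γ + NT := by
    rcases Nat.eq_zero_or_pos NT with rfl | h
    · have : (0 : ℝ) < NS := by simpa using hNr
      positivity
    · have : (0 : ℝ) < NT := by exact_mod_cast h
      positivity
  have hdiv := natCast_div_eq_ofReal NT NS hN
  -- Since `y ≥ x/γ`, the mixture is at least `(NT + NS/γ)/(NT + NS)` times `x`; the leading factor
  -- is the reciprocal.
  calc x = ENNReal.ofReal (((NS : ℝ) + NT) / (NS / γ + NT)) *
        (ENNReal.ofReal (NT / (NT + NS)) * x +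
          ENNReal.ofReal (NS / (NT + NS)) * (ENNReal.ofReal γ⁻¹ * x)) := by
        rw [← mul_assoc (ENNReal.ofReal (NS / (NT + NS))), ← add_mul, ← mul_assoc,
          ← ENNReal.ofReal_mul (by positivity), ← ENNReal.ofReal_add (by positivity)
            (by positivity), ← ENNReal.ofReal_mul (by positivity)]
        have : ((NS : ℝ) + NT) / (NS / γ + NT) * (NT / (NT + NS) + NS / (NT + NS) * γ⁻¹) = 1 := by
          have h3 : (NT : ℝ) / (NT + NS) + NS / (NT + NS) * γ⁻¹ =
              (NS / γ + NT) / (NS + NT) := by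
            rw [add_comm (NS : ℝ)]; field_simp; ring
          rw [h3, div_mul_div_comm, mul_comm, div_self (mul_pos hden (by linarith)).ne']
        rw [this]; simp
    _ ≤ _ := by rw [hdiv, hdiv]; gcongr

theorem RCPolicy.toKernel_apply [SFinite μ] (p : RCPolicy S μ) (x : S × ℝ) :
    p.toKernel x = μ.withDensity fun a => ENNReal.ofReal (p.density x.1 x.2 a) := by
  have h : Measurable (Function.uncurry fun (x : S × ℝ) (a : A) =>
      ENNReal.ofReal (p.density x.1 x.2 a)) := p.measurable_density.ennreal_ofReal
  rw [RCPolicy.toKernel, Kernel.withDensity_apply _ h]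
  rfl

/-- The logarithm of the likelihood ratio of two policies. -/
noncomputable def logRatio (p q : RCPolicy S μ) (x : S × A × ℝ) : ℝ :=
  Real.log (p.density x.1 x.2.2 x.2.1) - Real.log (q.density x.1 x.2.2 x.2.1)

theorem measurable_logRatio (p q : RCPolicy S μ) : Measurable (logRatio p q) := by
  have h : ∀ p : RCPolicy S μ, Measurable fun x : S × A × ℝ => p.density x.1 x.2.2 x.2.1 :=
    fun p => p.measurable_density.comp
      (by fun_prop : Measurable fun x : S × A × ℝ => ((x.1, x.2.2), x.2.1))
  exact (h p).log.sub (h q).log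

/-- The part of the divergence depending only on the data law cancels between two losses, leaving a
mean log-likelihood ratio. Disintegration then replaces "`g`, then `a` given `g`" by "`a`, then `g`
given `a`", the form in which relabelling acts. -/
theorem loss_add_le [StandardBorelSpace A] [Nonempty A] [SigmaFinite μ] (p q : RCPolicy S μ)
    (hp : ∀ s g a, 0 < p.density s g a) (hq : ∀ s g a, 0 < q.density s g a) {m : ℝ}
    (hm : ∀ x, |logRatio p q x| ≤ m) [IsProbabilityMeasure (mixOccupancy src tgt β NT NS)] :
    loss src tgt β NT NS q + ENNReal.ofReal m ≤ loss src tgt β NT NS p +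
      ∫⁻ s, ∫⁻ a, ∫⁻ g, ENNReal.ofReal (logRatio p q (s, a, g) + m) ∂tgt.returnGivenSA β (s, a)
        ∂β s ∂mixOccupancy src tgt β NT NS := by
  have : IsMarkovKernel (tgt.returnGivenS β) := by rw [MDP.returnGivenS]; infer_instance
  have hw := measurable_logRatio p q
  have hkl := measurable_klDiv_kernel (tgt.actionGiven β) p.toKernel
  have hF : Measurable fun x : S × A × ℝ => ENNReal.ofReal (logRatio p q x + m) := by fun_prop
  have hdis : ∀ s, ∫⁻ a, ∫⁻ g, ENNReal.ofReal (logRatio p q (s, a, g) + m)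
      ∂tgt.returnGivenSA β (s, a) ∂β s = ∫⁻ g, ∫⁻ a, ENNReal.ofReal (logRatio p q (s, a, g) + m)
        ∂tgt.actionGiven β (s, g) ∂tgt.returnGivenS β s := fun s => by
    have hG : Measurable fun x : ℝ × A => ENNReal.ofReal (logRatio p q (s, x.2, x.1) + m) :=
      hF.comp (by fun_prop : Measurable fun x : ℝ × A => (s, x.2, x.1))
    rw [tgt.lintegral_actionGiven β s hG, tgt.lintegral_returnAction β s hG]
  have hm1 : ∀ s, Measurable fun g => klDiv (tgt.actionGiven β (s, g)) (p.toKernel (s, g)) :=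
    fun s => hkl.comp (by fun_prop : Measurable fun g : ℝ => (s, g))
  have hm2 : Measurable fun s => ∫⁻ g, klDiv (tgt.actionGiven β (s, g)) (p.toKernel (s, g))
      ∂tgt.returnGivenS β s :=
    Measurable.lintegral_kernel_prod_right' (κ := tgt.returnGivenS β)
      (f := fun y : S × ℝ => klDiv (tgt.actionGiven β y) (p.toKernel y)) hkl
  have hpt : ∀ s g, klDiv (tgt.actionGiven β (s, g)) (q.toKernel (s, g)) + ENNReal.ofReal m ≤
      klDiv (tgt.actionGiven β (s, g)) (p.toKernel (s, g)) +
        ∫⁻ a, ENNReal.ofReal (logRatio p q (s, a, g) + m) ∂tgt.actionGiven β (s, g) := by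
    intro s g
    have hd : ∀ p : RCPolicy S μ, Measurable fun a => p.density s g a := fun p =>
      p.measurable_density.comp (by fun_prop : Measurable fun a : A => ((s, g), a))
    have h1 : ∀ p : RCPolicy S μ, IsProbabilityMeasure
        (μ.withDensity fun a => ENNReal.ofReal (p.density s g a)) := fun p => by
      have := RCPolicy.toKernel_apply p (s, g)
      rw [← this]; infer_instance
    have := h1 p
    have := h1 q
    rw [RCPolicy.toKernel_apply, RCPolicy.toKernel_apply]
    exact klDiv_withDensity_add_le (tgt.actionGiven β (s, g)) μ (hd p) (hd q) (hp s g) (hq s g)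
      fun a => hm (s, a, g)
  calc loss src tgt β NT NS q + ENNReal.ofReal m
      = ∫⁻ s, ∫⁻ g, (klDiv (tgt.actionGiven β (s, g)) (q.toKernel (s, g)) + ENNReal.ofReal m)
          ∂tgt.returnGivenS β s ∂mixOccupancy src tgt β NT NS := by
        have h1 : ∀ s, ∫⁻ g, (klDiv (tgt.actionGiven β (s, g)) (q.toKernel (s, g)) +
            ENNReal.ofReal m) ∂tgt.returnGivenS β s =
            ENNReal.ofReal m + ∫⁻ g, klDiv (tgt.actionGiven β (s, g)) (q.toKernel (s, g))
              ∂tgt.returnGivenS β s := fun s => by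
          rw [← lintegral_const_add]; simp_rw [add_comm]
        simp_rw [h1]
        rw [lintegral_const_add, add_comm, loss]
    _ ≤ ∫⁻ s, ∫⁻ g, (klDiv (tgt.actionGiven β (s, g)) (p.toKernel (s, g)) +
          ∫⁻ a, ENNReal.ofReal (logRatio p q (s, a, g) + m) ∂tgt.actionGiven β (s, g))
          ∂tgt.returnGivenS β s ∂mixOccupancy src tgt β NT NS :=
        lintegral_mono fun s => lintegral_mono fun g => hpt s g
    _ = _ := by
        rw [loss, ← lintegral_add_left hm2]
        refine lintegral_congr fun s => ?_
        rw [lintegral_add_left (hm1 s), hdis s]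

end Loss

/-! ### Bounds and means of sums along a trajectory. -/

section TrajectoryMean

variable {S A : Type*} [MeasurableSpace S] [MeasurableSpace A] {E : Episode S}

theorem trajSum_mem_Icc {S A : Type*} {w : S × A × ℝ → ℝ} {a b : ℝ}
    (hw : ∀ x, w x ∈ Set.Icc a b) {n : ℕ} (τ : Traj S A n) :
    trajSum w τ ∈ Set.Icc (n * a) (n * b) := by
  constructor
  · have := Finset.card_nsmul_le_sum Finset.univ
      (fun h => w ((τ h).1, (τ h).2.1, returnToGo τ h)) a fun h _ => (hw _).1
    simpa [trajSum] using this
  · have := Finset.sum_le_card_nsmul Finset.univ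
      (fun h => w ((τ h).1, (τ h).2.1, returnToGo τ h)) b fun h _ => (hw _).2
    simpa [trajSum] using this

theorem lintegral_trajSum_ofReal (M : MDP E A) (β : Kernel S A) [IsMarkovKernel β]
    {w : S × A × ℝ → ℝ} (hw : Measurable w) {m : ℝ} (hm : ∀ x, |w x| ≤ m) :
    ∫⁻ τ, trajSum (fun x => ENNReal.ofReal (w x + m)) τ ∂M.trajMeasure β =
      ENNReal.ofReal (∫ τ, trajSum w τ ∂M.trajMeasure β + E.H * m) := by
  have hb : ∀ x, 0 ≤ w x + m := fun x => by linarith [(abs_le.1 (hm x)).1]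
  have hms := measurable_trajSum hw E.H
  have hint : Integrable (fun τ : Traj S A E.H => trajSum w τ) (M.trajMeasure β) :=
    Integrable.of_mem_Icc _ _ hms.aemeasurable
      (ae_of_all _ fun τ => trajSum_mem_Icc (fun x => abs_le.1 (hm x)) τ)
  have h1 : ∀ τ : Traj S A E.H, trajSum (fun x => ENNReal.ofReal (w x + m)) τ =
      ENNReal.ofReal (trajSum w τ + E.H * m) := fun τ => by
    rw [trajSum, ← ENNReal.ofReal_sum_of_nonneg fun _ _ => hb _]
    simp [trajSum, Finset.sum_add_distrib]
  have hint2 : Integrable (fun τ : Traj S A E.H => trajSum w τ + E.H * m) (M.trajMeasure β) :=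
    hint.add (integrable_const _)
  simp_rw [h1]
  rw [← ofReal_integral_eq_lintegral_ofReal hint2 (ae_of_all _ fun τ => by
    have := (trajSum_mem_Icc (fun x => abs_le.1 (hm x)) τ).1
    simp only [Pi.zero_apply]; linarith)]
  simp [integral_add hint (integrable_const _)]

end TrajectoryMean

/-! ### Maximum likelihood on the relabelled mixed data. -/

section Estimation

variable {S A : Type*} [MeasurableSpace S] [MeasurableSpace A] {E : Episode S}
  (src tgt : MDP E A) (β : Kernel S A) [IsMarkovKernel β] {μ : Measure A} (NT NS : ℕ)

/-- Replace the return-to-go by its relabelled value. -/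
noncomputable def relabelTriple (x : S × A × ℝ) : S × A × ℝ :=
  (x.1, x.2.1, relabel src tgt β x.1 x.2.1 x.2.2)

theorem measurable_relabelTriple : Measurable (relabelTriple src tgt β) :=
  measurable_fst.prodMk ((measurable_fst.comp measurable_snd).prodMk
    (measurable_relabel β src tgt))

/-- The mean of the log-likelihood ratio over the relabelled mixed data. -/
noncomputable def meanRatio (p q : RCPolicy S μ) : ℝ :=
  NT * ∫ τ, trajSum (logRatio p q) τ ∂tgt.trajMeasure β +
    NS * ∫ τ, trajSum (logRatio p q ∘ relabelTriple src tgt β) τ ∂src.trajMeasure β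

/-- Given the state, target data and relabelled source data have the same law of action and return,
hence the same conditional mean `Φ`. They differ only in the state occupancy, and the weights `NT`,
`NS` produce the mixture. -/
theorem lintegral_logRatio (hψ : CDFCompatible src tgt β) (hN : 0 < NT + NS) (hH : E.H ≠ 0)
    (p q : RCPolicy S μ) {m : ℝ} (hm : ∀ x, |logRatio p q x| ≤ m) :
    ∫⁻ s, ∫⁻ a, ∫⁻ g, ENNReal.ofReal (logRatio p q (s, a, g) + m) ∂tgt.returnGivenSA β (s, a)
        ∂β s ∂mixOccupancy src tgt β NT NS =
      ENNReal.ofReal (meanRatio src tgt β NT NS p q / ((NT + NS) * E.H) + m) := by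
  have hw := measurable_logRatio p q
  have hr := measurable_relabelTriple src tgt β
  have hF : Measurable fun x : S × A × ℝ => ENNReal.ofReal (logRatio p q x + m) := by fun_prop
  have hF' : Measurable fun x : S × A × ℝ =>
      ENNReal.ofReal ((logRatio p q ∘ relabelTriple src tgt β) x + m) := by fun_prop
  set Φ : S → ℝ≥0∞ := fun s => ∫⁻ a, ∫⁻ g, ENNReal.ofReal (logRatio p q (s, a, g) + m)
    ∂tgt.returnGivenSA β (s, a) ∂β s with hΦ
  have hH0 : (0 : ℝ) < E.H := by exact_mod_cast Nat.pos_of_ne_zero hH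
  have hNr : (0 : ℝ) < NT + NS := by exact_mod_cast hN
  have hlow : ∀ (M : MDP E A) (w : S × A × ℝ → ℝ), (∀ x, |w x| ≤ m) →
      0 ≤ ∫ τ, trajSum w τ ∂M.trajMeasure β + E.H * m := fun M w hwm => by
    have := norm_integral_le_of_norm_le_const (μ := M.trajMeasure β)
      (f := fun τ : Traj S A E.H => trajSum w τ) (C := E.H * m) (ae_of_all _ fun τ => by
        rw [Real.norm_eq_abs, abs_le, ← mul_neg]
        exact trajSum_mem_Icc (fun x => abs_le.1 (hwm x)) τ)
    rw [probReal_univ, mul_one, Real.norm_eq_abs] at this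
    linarith [(abs_le.1 this).1]
  have hdivide : ∀ (x : ℝ≥0∞) (y : ℝ), E.H * x = ENNReal.ofReal y →
      x = ENNReal.ofReal (y / E.H) := fun x y hxy => by
    rw [ENNReal.ofReal_div_of_pos hH0, ← hxy, ENNReal.ofReal_natCast]
    rw [ENNReal.eq_div_iff (by exact_mod_cast hH) (by simp)]
  have hT := hdivide _ _ ((tgt.lintegral_trajSum β hF hH).symm.trans
    (lintegral_trajSum_ofReal tgt β hw hm))
  have hS := hdivide _ _ ((src.lintegral_trajSum β hF' hH).symm.trans
    (lintegral_trajSum_ofReal src β (hw.comp hr) fun x => hm _))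
  have := src.isProbabilityMeasure_occupancy β hH
  have hS' : ∫⁻ s, ∫⁻ a, ∫⁻ g, ENNReal.ofReal
      ((logRatio p q ∘ relabelTriple src tgt β) (s, a, g) + m) ∂src.returnGivenSA β (s, a)
        ∂β s ∂src.occupancy β = ∫⁻ s, Φ s ∂src.occupancy β := by
    refine lintegral_congr_ae ?_
    filter_upwards [Measure.ae_ae_of_ae_compProd hψ] with s hs
    refine lintegral_congr_ae ?_
    filter_upwards [hs] with a ha
    exact lintegral_relabel β src tgt s a ha
      (G := fun g => ENNReal.ofReal (logRatio p q (s, a, g) + m)) (by fun_prop)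
  rw [hS'] at hS
  have h1 := hlow tgt _ hm
  have h2 := hlow src (logRatio p q ∘ relabelTriple src tgt β) fun x => hm _
  rw [lintegral_mixOccupancy, hT, hS, natCast_div_eq_ofReal NT NS hN,
    natCast_div_eq_ofReal NT NS hN, ← ENNReal.ofReal_mul (by positivity),
    ← ENNReal.ofReal_mul (by positivity), ← ENNReal.ofReal_add (by positivity) (by positivity)]
  congr 1
  rw [meanRatio]
  field_simp
  ring

/-- Maximum likelihood estimation: with high probability the loss of an empirical minimizer is
close to the loss of a competitor in the policy class. -/
theorem dataLaw_minimizer_loss_gt_le [StandardBorelSpace A] [Nonempty A] [SigmaFinite μ]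
    [Nonempty S] (hψ : CDFCompatible src tgt β) (hN : 0 < NT + NS) (hH : E.H ≠ 0)
    (P : Finset (RCPolicy S μ)) {c : ℝ} (hpos : ∀ p ∈ P, ∀ s g a, 0 < p.density s g a)
    (hlog : ∀ p ∈ P, ∀ s g a s' g' a',
      |Real.log (p.density s g a) - Real.log (p.density s' g' a')| ≤ c)
    {p q : RCPolicy S μ} (hp : p ∈ P) (hq : q ∈ P) {L : ℝ} (hL : 0 ≤ L) :
    dataLaw src tgt β NT NS {D | IsEmpiricalMinimizer src tgt β P D q ∧
      ¬ loss src tgt β NT NS q ≤ loss src tgt β NT NS p +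
        ENNReal.ofReal (4 * c * √(L / (2 * (NT + NS))))} ≤ ENNReal.ofReal (Real.exp (-L)) := by
  have hw := measurable_logRatio p q
  have hw' := measurable_logRatio q p
  have hr := measurable_relabelTriple src tgt β
  have hH0 : (0 : ℝ) < E.H := by exact_mod_cast Nat.pos_of_ne_zero hH
  have hNr : (0 : ℝ) < NT + NS := by exact_mod_cast hN
  have := isProbabilityMeasure_mixOccupancy src tgt β NT NS hN hH
  obtain ⟨s₀⟩ := ‹Nonempty S›
  obtain ⟨a₀⟩ := ‹Nonempty A›
  have hc : 0 ≤ c := (abs_nonneg _).trans (hlog p hp s₀ 0 a₀ s₀ 0 a₀)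
  set v₀ := logRatio q p (s₀, a₀, 0)
  -- Each of the two log-densities oscillates by at most `c`, so the ratio stays within `2c` of a
  -- reference value. Trajectory sums then lie in an interval of length `4cH`.
  have hosc : ∀ x, logRatio q p x ∈ Set.Icc (v₀ - 2 * c) (v₀ + 2 * c) := fun x => by
    have h1 := abs_le.1 (hlog p hp x.1 x.2.2 x.2.1 s₀ 0 a₀)
    have h2 := abs_le.1 (hlog q hq x.1 x.2.2 x.2.1 s₀ 0 a₀)
    simp only [v₀, logRatio, Set.mem_Icc]
    constructor <;> linarith [h1.1, h1.2, h2.1, h2.2]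
  have hneg : ∀ x, logRatio q p x = -logRatio p q x := fun x => by simp [logRatio]
  have hbd : ∀ x, |logRatio p q x| ≤ |v₀| + 2 * c := fun x => by
    have := hosc x
    rw [hneg] at this
    rw [abs_le]
    constructor <;> linarith [this.1, this.2, neg_abs_le v₀, le_abs_self v₀]
  have hhoeff := measure_sum_gt_le (tgt.trajMeasure β) (src.trajMeasure β)
    (u := trajSum (logRatio q p)) (v := trajSum (logRatio q p ∘ relabelTriple src tgt β))
    (measurable_trajSum hw' _) (measurable_trajSum (hw'.comp hr) _)
    (a := E.H * (v₀ - 2 * c)) (b := E.H * (v₀ + 2 * c)) (by gcongr; linarith)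
    (fun τ => trajSum_mem_Icc hosc τ) (fun τ => trajSum_mem_Icc (fun x => hosc _) τ) NT NS hN hL
  refine (measure_mono ?_).trans hhoeff
  rintro D ⟨hmin, hgt⟩
  rw [Set.mem_ofPred_eq]
  by_contra! hle
  refine hgt ?_
  set t := 4 * c * √(L / (2 * (NT + NS)))
  -- Minimality of `q` makes the empirical sum nonnegative. Without a large deviation its mean
  -- cannot be very negative, which bounds the excess loss of `q` over `p`.
  have hemp : 0 ≤ ∑ i, trajSum (logRatio q p) (D.1 i) +
      ∑ j, trajSum (logRatio q p ∘ relabelTriple src tgt β) (D.2 j) := by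
    have := hmin.2 p hp
    simp only [empLoss] at this
    simp only [trajSum, logRatio, relabelTriple, Function.comp, Finset.sum_sub_distrib]
    linarith
  have hmean : NT * ∫ τ, trajSum (logRatio q p) τ ∂tgt.trajMeasure β +
      NS * ∫ τ, trajSum (logRatio q p ∘ relabelTriple src tgt β) τ ∂src.trajMeasure β =
      -meanRatio src tgt β NT NS p q := by
    have h1 : ∀ τ : Traj S A E.H, trajSum (logRatio q p) τ = -trajSum (logRatio p q) τ :=
      fun τ => by simp [trajSum, hneg]
    have h2 : ∀ τ : Traj S A E.H, trajSum (logRatio q p ∘ relabelTriple src tgt β) τ =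
        -trajSum (logRatio p q ∘ relabelTriple src tgt β) τ :=
      fun τ => by simp [trajSum, hneg]
    simp_rw [h1, h2, integral_neg, meanRatio]
    ring
  -- `t` is such that `(NT + NS) H t` equals the Hoeffding threshold `4cH √((NT + NS) L / 2)`.
  have hmt : meanRatio src tgt β NT NS p q / ((NT + NS) * E.H) ≤ t := by
    rw [div_le_iff₀ (by positivity)]
    simp only [Finset.sum_sub_distrib, Finset.sum_const, Finset.card_univ, Fintype.card_fin,
      nsmul_eq_mul] at hle
    have hsq : √((NT + NS) * L / 2) = (NT + NS) * √(L / (2 * (NT + NS))) := by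
      rw [← Real.sqrt_sq hNr.le, ← Real.sqrt_mul (by positivity), Real.sqrt_sq hNr.le]
      congr 1
      field_simp
    rw [hsq] at hle
    have : t * ((NT + NS) * E.H) = (E.H * (v₀ + 2 * c) - E.H * (v₀ - 2 * c)) *
        ((NT + NS) * √(L / (2 * (NT + NS)))) := by simp only [t]; ring
    rw [this]
    linarith
  have hloss := loss_add_le src tgt β NT NS p q (hpos p hp) (hpos q hq) hbd
  rw [lintegral_logRatio src tgt β NT NS hψ hN hH p q hbd] at hloss
  have hm0 : 0 ≤ |v₀| + 2 * c := by positivity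
  have hloss' : loss src tgt β NT NS q + ENNReal.ofReal (|v₀| + 2 * c) ≤
      (loss src tgt β NT NS p + ENNReal.ofReal t) + ENNReal.ofReal (|v₀| + 2 * c) := by
    refine hloss.trans ?_
    rw [add_assoc, ← ENNReal.ofReal_add (by positivity) hm0]
    gcongr
  exact (ENNReal.add_le_add_iff_right (by simp)).1 hloss'

end Estimation
-- The value gap in terms of the population loss.
section ValueGap

theorem measurable_lastShortfall {S A : Type*} [MeasurableSpace S]
    [MeasurableSpace A] {E : Episode S} (M : MDP E A) (π : Kernel S A) [IsMarkovKernel π] {f : S → ℝ}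
    (hf : Measurable f) :
    Measurable fun s => ∫⁻ a, ∫⁻ x, ENNReal.ofReal (f s - x.1) ∂M.step (s, a) ∂π s :=
  Measurable.lintegral_kernel_prod_right' (κ := π)
    (f := fun y : S × A => ∫⁻ x, ENNReal.ofReal (f y.1 - x.1) ∂M.step y)
    (Measurable.lintegral_kernel_prod_right' (κ := M.step)
      (f := fun z : (S × A) × (ℝ × S) => ENNReal.ofReal (f z.1.1 - z.2.1)) (by fun_prop))

open InformationTheory

variable {S A : Type*} [MeasurableSpace S] [MeasurableSpace A]
  [StandardBorelSpace A] [Nonempty A] {E : Episode S}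
  (src tgt : MDP E A) (β : Kernel S A) [IsMarkovKernel β] {μ : Measure A} [SigmaFinite μ]

/-- The expected divergence at the conditioning return is controlled by the population loss. -/
theorem lintegral_klDiv_conditionOn_le {f : S → ℝ} (hf : Measurable f) {C α γ : ℝ} (hα : 0 < α)
    (hγ : 0 < γ) {NT NS : ℕ} (hN : 0 < NT + NS)
    (h : CoverageAssumption src tgt β f hf C α γ) (p : RCPolicy S μ) :
    ∫⁻ s, klDiv (tgt.actionGiven β (s, f s)) (p.toKernel (s, f s))
        ∂tgt.occupancy (conditionOn (tgt.actionGiven β) f hf) ≤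
      ENNReal.ofReal (C / α * (((NS : ℝ) + NT) / (NS / γ + NT))) * loss src tgt β NT NS p := by
  have : IsMarkovKernel (tgt.returnGivenS β) := by rw [MDP.returnGivenS]; infer_instance
  set occ := tgt.occupancy (conditionOn (tgt.actionGiven β) f hf)
  set k : S → ℝ → ℝ≥0∞ := fun s g => klDiv (tgt.actionGiven β (s, g)) (p.toKernel (s, g))
  -- `f s` is an atom of mass at least `α`, so the value there is at most `α⁻¹` times the mean over
  -- returns.
  have hpt : ∀ᵐ s ∂occ, k s (f s) ≤ ENNReal.ofReal α⁻¹ * ∫⁻ g, k s g ∂tgt.returnGivenS β s := by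
    filter_upwards [h.coverage] with s hs
    have h1 : ENNReal.ofReal α ≤ tgt.returnGivenS β s {f s} :=
      (ENNReal.ofReal_le_iff_le_toReal (measure_ne_top _ _)).2 hs
    calc k s (f s) = ENNReal.ofReal α⁻¹ * (k s (f s) * ENNReal.ofReal α) := by
          rw [mul_comm (k s (f s)), ← mul_assoc, ← ENNReal.ofReal_mul (by positivity),
            inv_mul_cancel₀ hα.ne']
          simp
      _ ≤ ENNReal.ofReal α⁻¹ * (k s (f s) * tgt.returnGivenS β s {f s}) := by gcongr
      _ = ENNReal.ofReal α⁻¹ * ∫⁻ g in {f s}, k s g ∂tgt.returnGivenS β s := by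
          rw [Measure.restrict_singleton, lintegral_smul_measure, lintegral_dirac, mul_comm (k s _)]
          rfl
      _ ≤ _ := by exact mul_le_mul_right (setLIntegral_le_lintegral _ _) _
  calc ∫⁻ s, k s (f s) ∂occ
      ≤ ∫⁻ s, ENNReal.ofReal α⁻¹ * ∫⁻ g, k s g ∂tgt.returnGivenS β s ∂occ := lintegral_mono_ae hpt
    _ = ENNReal.ofReal α⁻¹ * ∫⁻ s, ∫⁻ g, k s g ∂tgt.returnGivenS β s ∂occ :=
        lintegral_const_mul' _ _ (by simp)
    _ ≤ ENNReal.ofReal α⁻¹ * (ENNReal.ofReal C *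
          ∫⁻ s, ∫⁻ g, k s g ∂tgt.returnGivenS β s ∂tgt.occupancy β) := by
        gcongr
        refine (lintegral_mono' h.mismatch le_rfl).trans ?_
        rw [lintegral_smul_measure]; rfl
    _ ≤ ENNReal.ofReal α⁻¹ * (ENNReal.ofReal C *
          (ENNReal.ofReal (((NS : ℝ) + NT) / (NS / γ + NT)) * loss src tgt β NT NS p)) := by
        gcongr
        exact lintegral_occupancy_le_mix src tgt β NT NS hγ hN h.overlap _
    _ = _ := by
        rw [← mul_assoc, ← mul_assoc, ← ENNReal.ofReal_mul (by positivity), ← ENNReal.ofReal_mul'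
          (by positivity)]
        congr 2
        ring

/-- The value gap of a policy in terms of its population loss, with a free parameter `l`. -/
theorem lintegral_returnFrom_star_le [MeasurableSingletonClass S] {f : S → ℝ} (hf : Measurable f)
    {r : S → A → ℝ} {T : S → A → S}
    (hr : Measurable (Function.uncurry r)) {πstar : S → A} (hπ : Measurable πstar)
    (hfopt : ∀ᵐ s ∂tgt.init, noiselessReturn r T πstar E.H s ≤ f s) {C α γ ε : ℝ} (hα : 0 < α)
    (hγ : 0 < γ) {NT NS : ℕ} (hN : 0 < NT + NS) (hH : E.H ≠ 0)
    (h₁ : MDPAssumption tgt β f r T α ε) (h₂ : CoverageAssumption src tgt β f hf C α γ)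
    (p : RCPolicy S μ) {l : ℝ} (hl : 0 < l) :
    ∫⁻ s, tgt.returnFrom (Kernel.deterministic πstar hπ) E.H s ∂tgt.init ≤
      ∫⁻ s, tgt.returnFrom (conditionOn p.toKernel f hf) E.H s ∂tgt.init +
        (E.H * (E.H * (ENNReal.ofReal (2 * l) + ENNReal.ofReal (1 / (2 * l)) *
            (ENNReal.ofReal (C / α * (((NS : ℝ) + NT) / (NS / γ + NT))) *
              loss src tgt β NT NS p))) +
          E.H * (ENNReal.ofReal ε + ENNReal.ofReal ε / ENNReal.ofReal α) +
          E.H * (E.H * ENNReal.ofReal ε)) := by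
  set ρ := conditionOn (tgt.actionGiven β) f hf
  set ρ' := conditionOn p.toKernel f hf
  have := tgt.isProbabilityMeasure_occupancy ρ hH
  have hε : ∀ s a, tgt.step (s, a) {x | x.1 ≠ r s a ∨ x.2 ≠ T s a} ≤ ENNReal.ofReal ε :=
    fun s a => by
      rw [← ofReal_measureReal]; exact ENNReal.ofReal_le_ofReal (h₁.near_det s a)
  -- the optimal policy
  have hA : ∫⁻ s, tgt.returnFrom (Kernel.deterministic πstar hπ) E.H s ∂tgt.init ≤
      ∫⁻ s, ENNReal.ofReal (f s) ∂tgt.init + E.H * (E.H * ENNReal.ofReal ε) := by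
    calc _ ≤ ∫⁻ s, (ENNReal.ofReal (f s) + E.H * (E.H * ENNReal.ofReal ε)) ∂tgt.init := by
          refine lintegral_mono_ae ?_
          filter_upwards [hfopt] with s hs
          refine (tgt.returnFrom_deterministic_le hπ hε E.H E.H le_rfl s).trans ?_
          gcongr
      _ = _ := by rw [lintegral_add_left hf.ennreal_ofReal]; simp
  -- the policy conditioned on the target law
  classical
  -- The shortfall is set to zero before the last time step, since only there is the return-to-go a
  -- single reward.
  set D₁ : S → ℝ≥0∞ := fun s => if s ∈ {s | E.time s + 1 = E.H} then
    ∫⁻ a, ∫⁻ x, ENNReal.ofReal (f s - x.1) ∂tgt.step (s, a) ∂ρ s else 0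
  have hD₁ : Measurable D₁ := by
    refine Measurable.ite ?_ (measurable_lastShortfall tgt ρ hf) measurable_const
    exact (E.measurable_time.add_const 1) (measurableSet_singleton E.H)
  have hB : ∫⁻ s, ENNReal.ofReal (f s) ∂tgt.init ≤ ∫⁻ s, tgt.returnFrom ρ E.H s ∂tgt.init +
      E.H * ∫⁻ s, D₁ s ∂tgt.occupancy ρ := by
    rw [← tgt.lintegral_visitSum ρ hD₁ hH, ← lintegral_add_left (tgt.measurable_returnFrom ρ _)]
    refine lintegral_mono_ae ?_
    filter_upwards [tgt.time_init] with s hs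
    obtain ⟨n, hn⟩ := Nat.exists_eq_succ_of_ne_zero hH
    rw [hn]
    refine tgt.ofReal_le_returnFrom_add ρ h₁.consistent hD₁ (fun s hs => ?_) n s (by omega)
    simp only [D₁]
    rw [if_pos (by exact hs)]
  have hB' : ∫⁻ s, D₁ s ∂tgt.occupancy ρ ≤
      ENNReal.ofReal ε + ENNReal.ofReal ε / ENNReal.ofReal α := by
    have : IsMarkovKernel (tgt.returnGivenS β) := by rw [MDP.returnGivenS]; infer_instance
    calc ∫⁻ s, D₁ s ∂tgt.occupancy ρ ≤
        ∫⁻ _, (ENNReal.ofReal ε + ENNReal.ofReal ε / ENNReal.ofReal α) ∂tgt.occupancy ρ := by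
          refine lintegral_mono_ae ?_
          filter_upwards [h₂.coverage] with s hs
          simp only [D₁]
          split_ifs with ht
          · refine tgt.lastStep_shortfall_le β s ht f hf hr (by simpa using hα) (fun a => ?_)
              ((ENNReal.ofReal_le_iff_le_toReal (measure_ne_top _ _)).2 hs)
            refine (measure_mono ?_).trans (hε s a)
            exact fun x hx => Or.inl hx
          · exact zero_le
      _ = _ := by simp
  -- the estimated policy
  have hkl : Measurable fun s => klDiv (tgt.actionGiven β (s, f s)) (p.toKernel (s, f s)) :=
    (measurable_klDiv_kernel (tgt.actionGiven β) p.toKernel).comp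
      (by fun_prop : Measurable fun s => (s, f s))
  set D₂ : S → ℝ≥0∞ := fun s => ENNReal.ofReal (2 * l) + ENNReal.ofReal (1 / (2 * l)) *
    klDiv (tgt.actionGiven β (s, f s)) (p.toKernel (s, f s))
  have hD₂ : Measurable D₂ := by fun_prop
  have hC : ∫⁻ s, tgt.returnFrom ρ E.H s ∂tgt.init ≤ ∫⁻ s, tgt.returnFrom ρ' E.H s ∂tgt.init +
      E.H * (E.H * ∫⁻ s, D₂ s ∂tgt.occupancy ρ) := by
    rw [← tgt.lintegral_visitSum ρ hD₂ hH, ← lintegral_const_mul' _ _ (by simp),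
      ← lintegral_add_left (tgt.measurable_returnFrom ρ' _)]
    refine lintegral_mono fun s => tgt.returnFrom_le_returnFrom_add ρ ρ' hD₂ ?_ _ _ le_rfl s
    exact fun s u hu hu1 => lintegral_le_add_klDiv _ _ hu hu1 hl
  have hC' : ∫⁻ s, D₂ s ∂tgt.occupancy ρ ≤ ENNReal.ofReal (2 * l) + ENNReal.ofReal (1 / (2 * l)) *
      (ENNReal.ofReal (C / α * (((NS : ℝ) + NT) / (NS / γ + NT))) * loss src tgt β NT NS p) := by
    rw [lintegral_const_add, lintegral_const_mul' _ _ (by simp)]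
    gcongr
    exact lintegral_klDiv_conditionOn_le src tgt β hf hα hγ hN h₂ p
  calc _ ≤ _ := hA
    _ ≤ (∫⁻ s, tgt.returnFrom ρ' E.H s ∂tgt.init + E.H * (E.H * ∫⁻ s, D₂ s ∂tgt.occupancy ρ) +
          E.H * ∫⁻ s, D₁ s ∂tgt.occupancy ρ) + E.H * (E.H * ENNReal.ofReal ε) :=
        add_le_add_left (hB.trans (add_le_add_left hC _)) _
    _ = ∫⁻ s, tgt.returnFrom ρ' E.H s ∂tgt.init + (E.H * (E.H * ∫⁻ s, D₂ s ∂tgt.occupancy ρ) +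
          E.H * ∫⁻ s, D₁ s ∂tgt.occupancy ρ + E.H * (E.H * ENNReal.ofReal ε)) := by ring
    _ ≤ _ := by gcongr

theorem one_le_of_le_smul {X : Type*} [MeasurableSpace X] (ν ρ : Measure X) [IsProbabilityMeasure ν]
    [IsProbabilityMeasure ρ] {k : ℝ} (h : ν ≤ ENNReal.ofReal k • ρ) : 1 ≤ k := by
  have := h Set.univ
  simpa using this

/-- The value gap of a policy in terms of its population loss. -/
theorem value_sub_value_le [MeasurableSingletonClass S] {f : S → ℝ} (hf : Measurable f)
    {r : S → A → ℝ} {T : S → A → S}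
    (hr : Measurable (Function.uncurry r)) {πstar : S → A} (hπ : Measurable πstar)
    (hfopt : ∀ᵐ s ∂tgt.init, noiselessReturn r T πstar E.H s ≤ f s) {C α γ ε : ℝ} (hα : 0 < α)
    (hγ : 0 < γ) (hC : 0 ≤ C) (hε : 0 ≤ ε) {NT NS : ℕ} (hN : 0 < NT + NS) (hH : E.H ≠ 0)
    (h₁ : MDPAssumption tgt β f r T α ε) (h₂ : CoverageAssumption src tgt β f hf C α γ)
    (p : RCPolicy S μ) {L : ℝ} (hL : 0 ≤ L) (hloss : loss src tgt β NT NS p ≤ ENNReal.ofReal L)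
    {l : ℝ} (hl : 0 < l) :
    tgt.value (Kernel.deterministic πstar hπ) - tgt.value (conditionOn p.toKernel f hf) ≤
      (E.H : ℝ) * (E.H * (2 * l + 1 / (2 * l) *
        (C / α * (((NS : ℝ) + NT) / (NS / γ + NT)) * L))) +
        E.H * (ε + ε / α) + E.H * (E.H * ε) := by
  have h := lintegral_returnFrom_star_le src tgt β hf hr hπ hfopt hα hγ hN hH h₁ h₂ p hl
  rw [MDP.value_eq, MDP.value_eq, sub_le_iff_le_add']
  set V := ∫⁻ s, tgt.returnFrom (conditionOn p.toKernel f hf) E.H s ∂tgt.init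
  have hV : V ≠ ⊤ := ((tgt.lintegral_returnFrom_le _).trans_lt (by simp)).ne
  have hX : ∫⁻ s, tgt.returnFrom (Kernel.deterministic πstar hπ) E.H s ∂tgt.init ≤
      V + ENNReal.ofReal ((E.H : ℝ) * (E.H * (2 * l + 1 / (2 * l) *
        (C / α * (((NS : ℝ) + NT) / (NS / γ + NT)) * L))) +
        E.H * (ε + ε / α) + E.H * (E.H * ε)) := by
    refine h.trans (add_le_add_right ?_ _)
    have hB : 0 ≤ C / α * (((NS : ℝ) + NT) / (NS / γ + NT)) := by positivity
    generalize C / α * (((NS : ℝ) + NT) / (NS / γ + NT)) = B at hB ⊢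
    have e1 : ENNReal.ofReal (E.H * (E.H * (2 * l + 1 / (2 * l) * (B * L)))) =
        E.H * (E.H * (ENNReal.ofReal (2 * l) + ENNReal.ofReal (1 / (2 * l)) *
          (ENNReal.ofReal B * ENNReal.ofReal L))) := by
      rw [ENNReal.ofReal_mul (by positivity), ENNReal.ofReal_mul (by positivity),
        ENNReal.ofReal_add (by positivity) (by positivity),
        ENNReal.ofReal_mul (p := 1 / (2 * l)) (by positivity), ENNReal.ofReal_mul hB,
        ENNReal.ofReal_natCast]
    have e2 : ENNReal.ofReal (E.H * (ε + ε / α)) =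
        E.H * (ENNReal.ofReal ε + ENNReal.ofReal ε / ENNReal.ofReal α) := by
      rw [ENNReal.ofReal_mul (by positivity), ENNReal.ofReal_add hε (by positivity),
        ENNReal.ofReal_div_of_pos hα, ENNReal.ofReal_natCast]
    have e3 : ENNReal.ofReal (E.H * (E.H * ε)) = E.H * (E.H * ENNReal.ofReal ε) := by
      rw [ENNReal.ofReal_mul (by positivity), ENNReal.ofReal_mul (by positivity),
        ENNReal.ofReal_natCast]
    rw [ENNReal.ofReal_add (by positivity) (by positivity),
      ENNReal.ofReal_add (by positivity) (by positivity), e1, e2, e3]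
    gcongr
  have := ENNReal.toReal_mono (by finiteness) hX
  rwa [ENNReal.toReal_add hV (by finiteness), ENNReal.toReal_ofReal (by positivity)] at this

end ValueGap

/-! ### Choice of the free parameter and simplification of the rate. -/

section Arithmetic

theorem le_sqrt_of_forall_pos {x y w b L : ℝ} (hw : 0 ≤ w) (hb : 1 ≤ b) (hL : 0 ≤ L)
    (h : ∀ l : ℝ, 0 < l → x ≤ w * (2 * l + 1 / (2 * l) * (b * L)) + y) :
    x ≤ w * (5 / 2 * b * √L) + y := by
  rcases hL.eq_or_lt with rfl | hL
  · simp only [mul_zero, add_zero, Real.sqrt_zero] at h ⊢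
    refine le_of_forall_pos_le_add fun d hd => ?_
    -- For `L = 0` the bound is the limit `l → 0`; this `l` makes the error at most `d`.
    have h1 := h (d / (2 * (w + 1))) (by positivity)
    have h2 : w * (2 * (d / (2 * (w + 1)))) ≤ d := by
      have : w * (2 * (d / (2 * (w + 1)))) = w / (w + 1) * d := by field_simp
      rw [this]
      have : w / (w + 1) ≤ 1 := by rw [div_le_one (by positivity)]; linarith
      nlinarith
    linarith
  · have hs : 0 < √L := Real.sqrt_pos.2 hL
    -- This choice gives `2√L + b√L/2`, and `1 ≤ b` absorbs the first term: `5/2 = 2 + 1/2`.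
    refine (h (√L) hs).trans ?_
    have h1 : 1 / (2 * √L) * (b * L) = b * √L / 2 := by
      nth_rw 2 [← Real.sq_sqrt hL.le]; field_simp
    rw [h1]
    have : 2 * √L + b * √L / 2 ≤ 5 / 2 * b * √L := by nlinarith
    have := mul_le_mul_of_nonneg_left this hw
    linarith

/-- Subadditivity of the square root. A negative `ea` is replaced by `0`, which does not change
`√ea`. -/
theorem sqrt_add_le {ea c L n : ℝ} (hc : 0 ≤ c) (hL : 0 ≤ L) (hn : 0 < n) :
    √(max ea 0 + 4 * c * √(L / (2 * n))) ≤ 2 * (√c * (L / n) ^ (1 / 4 : ℝ) + √ea) := by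
  have h1 : √(max ea 0) = √ea := by
    rcases le_total 0 ea with h | h
    · rw [max_eq_left h]
    · rw [max_eq_right h, Real.sqrt_zero, Real.sqrt_eq_zero_of_nonpos h]
  have h2 : √(L / (2 * n)) ≤ √(L / n) := by
    refine Real.sqrt_le_sqrt ?_
    gcongr
    linarith
  have h3 : √√(L / n) = (L / n) ^ (1 / 4 : ℝ) := by
    rw [Real.sqrt_eq_rpow, Real.sqrt_eq_rpow, ← Real.rpow_mul (by positivity)]
    norm_num
  have h4 : √(4 * c * √(L / (2 * n))) ≤ 2 * (√c * (L / n) ^ (1 / 4 : ℝ)) := by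
    calc √(4 * c * √(L / (2 * n))) ≤ √(4 * c * √(L / n)) := by gcongr
      _ = _ := by
        rw [Real.sqrt_mul (by positivity), Real.sqrt_mul (by positivity), h3]
        have : √(4 : ℝ) = 2 := by rw [show (4 : ℝ) = 2 ^ 2 by norm_num]; simp
        rw [this]; ring
  have h5 : ∀ x y : ℝ, 0 ≤ x → 0 ≤ y → √(x + y) ≤ √x + √y := fun x y hx hy => by
    rw [Real.sqrt_le_iff]
    refine ⟨by positivity, ?_⟩
    have := mul_nonneg (Real.sqrt_nonneg x) (Real.sqrt_nonneg y)
    nlinarith [Real.sq_sqrt hx, Real.sq_sqrt hy]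
  have h6 := h5 (max ea 0) (4 * c * √(L / (2 * n))) (le_max_right ea 0) (by positivity)
  have := Real.sqrt_nonneg ea
  linarith

end Arithmetic
end RCSL

/-! ### The main theorem: union bound and assembly of the constants. -/

theorem mainTheorem1 :
    ∃ K : ℝ, 0 < K ∧
      ∀ (S A : Type*) [MeasurableSpace S] [StandardBorelSpace S]
        [MeasurableSpace A] [StandardBorelSpace A] [Nonempty A]
        (E : RCSL.Episode S) (src tgt : RCSL.MDP E A)
        (β : Kernel S A) [IsMarkovKernel β]
        -- the noiseless dynamics, an optimal target policy and the conditioning function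
        (r : S → A → ℝ) (T : S → A → S)
        (_hr : Measurable (Function.uncurry r)) (_hT : Measurable (Function.uncurry T))
        (πstar : S → A) (hπstar : Measurable πstar) (_hopt : RCSL.IsOptimal tgt πstar hπstar)
        (f : S → ℝ) (hf : Measurable f)
        (_hfopt : ∀ᵐ s ∂tgt.init, RCSL.noiselessReturn r T πstar E.H s ≤ f s)
        -- the policy class
        (μ : Measure A) [SigmaFinite μ] (P : Finset (RCSL.RCPolicy S μ))
        (NT NS : ℕ) (α ε C γ c εapprox δ : ℝ)
        (_hN : 0 < NT + NS) (_hα : 0 < α) (_hγ : 0 < γ) (_hδ : 0 < δ) (_hδ' : δ < 1)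
        (_hψ : RCSL.CDFCompatible src tgt β)
        (_h₁ : RCSL.MDPAssumption tgt β f r T α ε)
        (_h₂ : RCSL.CoverageAssumption src tgt β f hf C α γ)
        (_h₃ : RCSL.EstimationAssumption src tgt β NT NS P c εapprox),
        ENNReal.ofReal (1 - δ) ≤ RCSL.dataLaw src tgt β NT NS
          {D | ∀ p, RCSL.IsEmpiricalMinimizer src tgt β P D p →
            tgt.value (Kernel.deterministic πstar hπstar)
                - tgt.value (RCSL.conditionOn p.toKernel f hf)
              ≤ K * (C / α * (((NS : ℝ) + NT) / (NS / γ + NT)) * (E.H : ℝ) ^ 2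
                    * (√c * (Real.log (P.card / δ) / ((NT : ℝ) + NS)) ^ (1 / 4 : ℝ) + √εapprox)
                  + ε / α * (E.H : ℝ) ^ 2)
            ∧ tgt.value (Kernel.deterministic πstar hπstar)
                - tgt.value (RCSL.conditionOn p.toKernel f hf)
              ≤ K * ((C * γ / α * (E.H : ℝ) ^ 2 * √c * (Real.log (P.card / δ)) ^ (1 / 4 : ℝ))
                    * ((NT : ℝ) + NS) ^ (-(1 / 4) : ℝ)
                  + (C * γ / α * (E.H : ℝ) ^ 2 * √εapprox + ε / α * (E.H : ℝ) ^ 2))} := by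
  -- `5 = 5/2 · 2`, from the choice of `l` and from `sqrt_add_le`; the noise terms need only `3`.
  refine ⟨5, by norm_num, ?_⟩
  intro S A _ _ _ _ _ E src tgt β _ r T hr hT πstar hπ hopt f hf hfopt μ _ P NT NS α ε C γ c εa δ
    hN hα hγ hδ hδ' hψ h₁ h₂ h₃
  have hprob : IsProbabilityMeasure (RCSL.dataLaw src tgt β NT NS) := by
    rw [RCSL.dataLaw]; infer_instance
  -- With horizon zero all values vanish; otherwise occupancies are probability measures.
  by_cases hH : E.H = 0
  · have hv : ∀ ρ : Kernel S A, [IsMarkovKernel ρ] → tgt.value ρ = 0 := fun ρ _ => by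
      have := tgt.lintegral_returnFrom_le ρ
      rw [hH, Nat.cast_zero, nonpos_iff_eq_zero] at this
      rw [RCSL.MDP.value_eq, hH, this, ENNReal.toReal_zero]
    refine (ENNReal.ofReal_le_one.2 (by linarith : 1 - δ ≤ 1)).trans ?_
    rw [← measure_univ (μ := RCSL.dataLaw src tgt β NT NS)]
    refine measure_mono fun D _ p _ => ?_
    simp [hv, hH]
  obtain ⟨s₀⟩ : Nonempty S := by
    by_contra h
    rw [not_nonempty_iff] at h
    exact IsProbabilityMeasure.ne_zero tgt.init (Measure.eq_zero_of_isEmpty _)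
  obtain ⟨a₀⟩ := ‹Nonempty A›
  obtain ⟨p₀, hp₀, happrox⟩ := h₃.approx
  have hc : 0 ≤ c := (abs_nonneg _).trans (h₃.log_ratio p₀ hp₀ s₀ 0 a₀ s₀ 0 a₀)
  have hε : 0 ≤ ε := measureReal_nonneg.trans (h₁.near_det s₀ a₀)
  have := tgt.isProbabilityMeasure_occupancy β hH
  have := src.isProbabilityMeasure_occupancy β hH
  have hocc := tgt.isProbabilityMeasure_occupancy (RCSL.conditionOn (tgt.actionGiven β) f hf) hH
  -- Comparing total masses gives `1 ≤ C` and `1 ≤ γ`. With `α ≤ 1` this yields `1 ≤ C / α * B₀`, as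
  -- the choice of `l` requires.
  have hC : 1 ≤ C := RCSL.one_le_of_le_smul _ _ h₂.mismatch
  have hγ1 : 1 ≤ γ := RCSL.one_le_of_le_smul _ _ h₂.overlap
  have hα1 : α ≤ 1 := by
    have : IsMarkovKernel (tgt.returnGivenS β) := by
      rw [RCSL.MDP.returnGivenS]; infer_instance
    obtain ⟨s, hs⟩ := h₂.coverage.exists
    exact hs.trans measureReal_le_one
  have hH1 : (1 : ℝ) ≤ E.H := by exact_mod_cast Nat.one_le_iff_ne_zero.2 hH
  have hNr : (0 : ℝ) < NT + NS := by exact_mod_cast hN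
  have hcard : (1 : ℝ) ≤ P.card := by exact_mod_cast Finset.card_pos.2 ⟨p₀, hp₀⟩
  have hratio : 1 ≤ P.card / δ := by rw [le_div_iff₀ hδ]; linarith
  set L := Real.log (P.card / δ) with hLdef
  have hL : 0 ≤ L := Real.log_nonneg hratio
  have hexp : Real.exp (-L) = δ / P.card := by
    rw [Real.exp_neg, hLdef, Real.exp_log (by positivity), inv_div]
  set t := 4 * c * √(L / (2 * (NT + NS))) with ht
  have ht0 : 0 ≤ t := by positivity
  have hden : 0 < (NS : ℝ) / γ + NT := by
    refine lt_of_lt_of_le (div_pos hNr hγ) ?_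
    rw [add_div, add_comm]
    gcongr
    exact div_le_self (by positivity) hγ1
  set B₀ := ((NS : ℝ) + NT) / (NS / γ + NT) with hB₀
  have hB₀1 : 1 ≤ B₀ := by
    rw [hB₀, le_div_iff₀ hden, one_mul]
    gcongr
    exact div_le_self (by positivity) hγ1
  -- The second bound follows from the first by this inequality, which rests on `1 ≤ γ`.
  have hB₀γ : B₀ ≤ γ := by
    rw [hB₀, div_le_iff₀ hden, mul_add, mul_div_cancel₀ _ hγ.ne']
    have : (0 : ℝ) ≤ NT := by positivity
    nlinarith
  have hCα : 1 ≤ C / α := by rw [le_div_iff₀ hα]; linarith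
  -- the deterministic part
  have hgap : ∀ p : RCSL.RCPolicy S μ, RCSL.loss src tgt β NT NS p ≤
        RCSL.loss src tgt β NT NS p₀ + ENNReal.ofReal t →
      tgt.value (Kernel.deterministic πstar hπ) - tgt.value (RCSL.conditionOn p.toKernel f hf) ≤
        5 * (C / α * B₀ * (E.H : ℝ) ^ 2 * (√c * (L / (NT + NS)) ^ (1 / 4 : ℝ) + √εa) +
          ε / α * (E.H : ℝ) ^ 2) := by
    intro p hp
    have hloss : RCSL.loss src tgt β NT NS p ≤ ENNReal.ofReal (max εa 0 + t) := by
      refine hp.trans ?_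
      rw [ENNReal.ofReal_add (le_max_right _ _) ht0]
      gcongr
      exact happrox.trans (ENNReal.ofReal_le_ofReal (le_max_left _ _))
    have hL' : 0 ≤ max εa 0 + t := add_nonneg (le_max_right _ _) ht0
    have h5 := RCSL.le_sqrt_of_forall_pos
      (x := tgt.value (Kernel.deterministic πstar hπ) -
        tgt.value (RCSL.conditionOn p.toKernel f hf)) (w := (E.H : ℝ) ^ 2)
      (y := E.H * (ε + ε / α) + E.H * (E.H * ε)) (b := C / α * B₀) (by positivity)
      (one_le_mul_of_one_le_of_one_le hCα hB₀1) hL' fun l hl => by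
        have := RCSL.value_sub_value_le src tgt β hf hr hπ hfopt hα hγ (by linarith) hε hN hH
          h₁ h₂ p hL' hloss hl
        refine this.trans (le_of_eq ?_)
        ring
    have hsq := RCSL.sqrt_add_le (ea := εa) hc hL hNr
    have hεα : ε ≤ ε / α := by rw [le_div_iff₀ hα]; nlinarith
    have hHH : (E.H : ℝ) ≤ (E.H : ℝ) ^ 2 := by nlinarith
    have h6 : E.H * (ε + ε / α) + E.H * (E.H * ε) ≤ 5 * (ε / α * (E.H : ℝ) ^ 2) := by
      have h7 : E.H * (ε + ε / α) ≤ (E.H : ℝ) ^ 2 * (ε / α + ε / α) := by gcongr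
      have h8 : E.H * (E.H * ε) ≤ (E.H : ℝ) ^ 2 * (ε / α) := by
        rw [← mul_assoc, ← sq]; gcongr
      have h9 : 0 ≤ (E.H : ℝ) ^ 2 * (ε / α) := by positivity
      linarith
    have h10 : (E.H : ℝ) ^ 2 * (5 / 2 * (C / α * B₀) * √(max εa 0 + t)) ≤
        (E.H : ℝ) ^ 2 * (5 / 2 * (C / α * B₀) *
          (2 * (√c * (L / (NT + NS)) ^ (1 / 4 : ℝ) + √εa))) := by
      gcongr
    calc _ ≤ _ := h5
      _ ≤ _ := add_le_add h10 h6
      _ = _ := by ring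
  -- the probabilistic part
  set bad : RCSL.RCPolicy S μ → Set (RCSL.Dataset S A E.H NT NS) := fun q =>
    {D | RCSL.IsEmpiricalMinimizer src tgt β P D q ∧ ¬ RCSL.loss src tgt β NT NS q ≤
      RCSL.loss src tgt β NT NS p₀ + ENNReal.ofReal t}
  have hbad : RCSL.dataLaw src tgt β NT NS (⋃ q ∈ P, bad q) ≤ ENNReal.ofReal δ := by
    have : Nonempty S := ⟨s₀⟩
    calc RCSL.dataLaw src tgt β NT NS (⋃ q ∈ P, bad q)
        ≤ ∑ q ∈ P, RCSL.dataLaw src tgt β NT NS (bad q) := measure_biUnion_finset_le _ _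
      _ ≤ ∑ _q ∈ P, ENNReal.ofReal (δ / P.card) := by
          refine Finset.sum_le_sum fun q hq => ?_
          rw [← hexp]
          exact RCSL.dataLaw_minimizer_loss_gt_le src tgt β NT NS hψ hN hH P h₃.pos h₃.log_ratio
            hp₀ hq hL
      _ = ENNReal.ofReal δ := by
          rw [Finset.sum_const, nsmul_eq_mul, ← ENNReal.ofReal_natCast,
            ← ENNReal.ofReal_mul (by positivity), mul_div_cancel₀ _ (by positivity)]
  -- Only subadditivity is used, so the bad events need not be measurable.
  have hgood : 1 - ENNReal.ofReal δ ≤ RCSL.dataLaw src tgt β NT NS (⋃ q ∈ P, bad q)ᶜ := by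
    rw [tsub_le_iff_right]
    calc (1 : ℝ≥0∞) = RCSL.dataLaw src tgt β NT NS ((⋃ q ∈ P, bad q)ᶜ ∪ ⋃ q ∈ P, bad q) := by
          rw [Set.compl_union_self, measure_univ]
      _ ≤ _ := (measure_union_le _ _).trans (by gcongr)
  rw [ENNReal.ofReal_sub _ hδ.le, ENNReal.ofReal_one]
  refine hgood.trans (measure_mono fun D hD p hp => ?_)
  have hlp : RCSL.loss src tgt β NT NS p ≤
      RCSL.loss src tgt β NT NS p₀ + ENNReal.ofReal t := by
    by_contra hcon
    exact hD (Set.mem_biUnion (Finset.mem_coe.2 hp.1) ⟨hp, hcon⟩)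
  refine ⟨hgap p hlp, (hgap p hlp).trans ?_⟩
  have hpow : (L / (NT + NS)) ^ (1 / 4 : ℝ) =
      L ^ (1 / 4 : ℝ) * ((NT : ℝ) + NS) ^ (-(1 / 4) : ℝ) := by
    rw [Real.div_rpow hL hNr.le, Real.rpow_neg hNr.le, div_eq_mul_inv]
  rw [hpow]
  have hle : C / α * B₀ * (E.H : ℝ) ^ 2 *
      (√c * (L ^ (1 / 4 : ℝ) * ((NT : ℝ) + NS) ^ (-(1 / 4) : ℝ)) + √εa) ≤
      C / α * γ * (E.H : ℝ) ^ 2 *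
      (√c * (L ^ (1 / 4 : ℝ) * ((NT : ℝ) + NS) ^ (-(1 / 4) : ℝ)) + √εa) := by
    gcongr
  calc _ ≤ _ := mul_le_mul_of_nonneg_left (add_le_add_left hle _) (by norm_num : (0 : ℝ) ≤ 5)
    _ = _ := by ring
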